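/- **Theorem (Inverting the CDF).** *Setting.* Let $H=\sum_k\lambda_k\Pi_k$ be a Hermitian matrix on a finite-dimensional complex Hilbert space (distinct eigenvalues $\lambda_k$, eigenprojections $\Pi_k$), $\rho$ a density matrix, $p_k=\mathrm{Tr}[\rho\Pi_k]$, and $\tau>0$ with $\tau\|H\|<\pi/3$ (operator norm). Let $\mathsf H$ be the $2\pi$-periodic Heaviside function ($1$ on $[2k\pi,(2k+1)\pi)$, $0$ on $[(2k-1)\pi,2k\pi)$, $k\in\mathbb Z$), and $C(x)=\sum_k p_k\,\mathsf H(x-\tau\lambda_k)$, the cumulative distribution function of the spectral measure of $\tau H$. *Problem 1.* For $0<\delta<\pi/6$ and $0<\eta<1$, find $x^\star\in(-\pi/3,\pi/3)$ with $C(x^\star+\delta)>\eta/2$ and $C(x^\star-\delta)<\eta$. *Samples.* For $d\in\mathbb N$ let $M_d(x)=T_d\big(1+2\tfrac{\cos x-\cos\delta'}{1+\cos\delta'}\big)/\mathcal N$ with $\delta'=\tfrac23\delta$, $T_d$ the $d$-th Chebyshev polynomial and $\mathcal N$ such that $\int_{-\pi}^{\pi}M_d=1$; let $F=M_d*\mathsf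 H$ (convolution over one period), $\hat F_j=\frac1{2\pi}\int_{-\pi}^{\pi}F(x)e^{-ijx}\,dx=|\hat F_j|e^{i\theta_j}$, and $\mathcal F=\sum_{|j|\le d}|\hat F_j|$. A sample $(J,Z)$ consists of $J\in\{-d,\dots,d\}$ with $\Pr[J=j]=|\hat F_j|/\mathcal F$, and of $Z=X_J+iY_J$, where, given $J=j$, $X_j$ and $Y_j$ are $\pm1$ according to the outcome $0$ or $1$ of measuring the ancilla in the Hadamard-test circuit (Hadamard gate on the ancilla, controlled $e^{-ij\tau H}$ on $\rho$, then $W$ and a Hadamard gate on the ancilla), with $W=I$ for $X_j$ and $W=S^\dagger$ for $Y_j$, $S$ being the phase gate. *Algorithm.* Given $M=N_bN_s$ samples $(J_k,Z_k)$, let $\bar G_r(x)$, $1\le r\le N_b$, be the average of $\mathrm{Re}\big(\mathcal F Z_ke^{i(\theta_{J_k}+J_kx)}\big)$ over the $r$-th batch of $N_s$ samples. $\mathtt{CERTIFY}(x)$ returns $0$ if $\bar G_r(x)>\tfrac34\eta$ for more than $N_b/2$ of the $r$, and $1$ otherwise. $\mathtt{INVERT\_CDF}$ starts from $x_0=-\pi/3$,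 $x_1=\pi/3$; while $x_1-x_0>2\delta$ it puts $x=(x_0+x_1)/2$ and replaces $x_1$ by $x+\tfrac23\delta$ if $\mathtt{CERTIFY}(x)=0$, and $x_0$ by $x-\tfrac23\delta$ if $\mathtt{CERTIFY}(x)=1$; it returns $(x_0+x_1)/2$. *Claim.* There are absolute constants $A>0$ and $\kappa\in\mathbb N$ such that for all $0<\delta<\pi/6$ and $0<\eta<1$ there is $$d\le A\,\delta^{-1}\log(\delta^{-1}\eta^{-1})$$ such that for every $0<\vartheta<1$ there are $N_b,N_s$ with $$M=N_bN_s\le A\,\eta^{-2}\log^2(d)\,\big(\log\log\delta^{-1}+\log(2\vartheta^{-1})\big)$$ for which the following holds. 1. On every array of $M$ samples, $\mathtt{INVERT\_CDF}$ stops after at most $A f\log^\kappa(2+f)$ elementary steps, where $f=\eta^{-2}\log^3(\delta^{-1})\log(2\vartheta^{-1})$; that is, the classical post-processing cost is $\widetilde{\mathcal O}(\eta^{-2}\log^3(\delta^{-1})\log(2\vartheta^{-1}))$. (Unit cost for each arithmetic operation, complex exponential, real part, comparison, loop iteration, and reading of a sample or of a precomputed value $\mathcal F$, $\theta_j$.)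 2. For all $H,\rho,\tau$ as above and all independent samples $(J_k,Z_k)_{k=1}^M$ as above, the output of $\mathtt{INVERT\_CDF}$ solves Problem 1 with probability at least $1-\vartheta$. 3. The expected total evolution time $\mathbb E\big[\sum_k\tau|J_k|\big]=\tau M\,\mathbb E|J|$ is at most $A\,\tau\,g\log^\kappa(2+g)$ with $g=\delta^{-1}\eta^{-2}\log(2\vartheta^{-1})$; that is, it is $\widetilde{\mathcal O}(\tau\delta^{-1}\eta^{-2}\log(2\vartheta^{-1}))$. 4. Almost surely $|J_k|\le d$ for all $k$, so the maximal evolution time is at most $\tau d\le A\,\tau\delta^{-1}\log(\delta^{-1}\eta^{-1})$. -/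

import Mathlib

namespace InvertCDF

open scoped Matrix Kronecker ComplexOrder
open MeasureTheory ProbabilityTheory

noncomputable section

/-! ### The approximate Heaviside function -/

/-- The `2π`-periodic Heaviside function: `1` on `[2kπ, (2k+1)π)` and `0` on `[(2k-1)π, 2kπ)`. -/
def heaviside (x : ℝ) : ℝ :=
  open Classical in
  if ∃ k : ℤ, 2 * k * Real.pi ≤ x ∧ x < (2 * k + 1) * Real.pi then 1 else 0

/-- The Chebyshev bump `T_d(1 + 2 (cos x - cos δ) / (1 + cos δ))`. -/
def bump (d : ℕ) (δ x : ℝ) : ℝ :=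
  (Polynomial.Chebyshev.T ℝ d).eval (1 + 2 * (Real.cos x - Real.cos δ) / (1 + Real.cos δ))

/-- The smeared Dirac function `M_{d,δ}`: the bump, normalised over one period. -/
def mollifier (d : ℕ) (δ x : ℝ) : ℝ :=
  bump d δ x / ∫ y in (-Real.pi)..Real.pi, bump d δ y

/-- The approximate Heaviside function `F_{d,δ} = M_{d,δ} * H` (convolution over one period). -/
def approxHeaviside (d : ℕ) (δ x : ℝ) : ℝ :=
  ∫ y in (-Real.pi)..Real.pi, mollifier d δ y * heaviside (x - y)

/-- The Fourier coefficient `F̂_j` of `F_{d,δ}`, normalised so that `F(x) = ∑ F̂_j e^{ijx}`. -/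
def coeff (d : ℕ) (δ : ℝ) (j : ℤ) : ℂ :=
  (1 / (2 * Real.pi) : ℂ) *
    ∫ x in (-Real.pi)..Real.pi, (approxHeaviside d δ x : ℂ) * Complex.exp (-(Complex.I * j * x))

/-- The normalisation factor `𝓕 = ∑_{|j| ≤ d} |F̂_j|`. -/
def totalWeight (d : ℕ) (F : ℤ → ℂ) : ℝ :=
  ∑ j ∈ Finset.Icc (-(d : ℤ)) d, ‖F j‖

/-- The distribution of `J`: `Pr[J = j] = |F̂_j| / 𝓕` for `|j| ≤ d`, and `0` for other `j`. -/
def probJ (d : ℕ) (F : ℤ → ℂ) (j : ℤ) : ℝ :=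
  if j ∈ Finset.Icc (-(d : ℤ)) d then ‖F j‖ / totalWeight d F else 0

/-- The expectation `𝔼|J|`. -/
def meanAbsJ (d : ℕ) (F : ℤ → ℂ) : ℝ :=
  ∑ j ∈ Finset.Icc (-(d : ℤ)) d, probJ d F j * |(j : ℝ)|

/-! ### The spectral measure and its cumulative distribution function -/

section Quantum

variable {ι : Type*} [Fintype ι] [DecidableEq ι]

/-- A density matrix: positive semidefinite with trace one. -/
def IsDensityMatrix (ρ : Matrix ι ι ℂ) : Prop :=
  ρ.PosSemidef ∧ ρ.trace = 1

/-- The orthogonal projection `Π_lam` onto the `lam`-eigenspace of `H`: the sum of `|v⟩⟨v|` over the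
members `v` of an orthonormal eigenbasis whose eigenvalue is `lam`. -/
def eigenProj {H : Matrix ι ι ℂ} (hH : H.IsHermitian) (lam : ℝ) : Matrix ι ι ℂ :=
  ∑ i with hH.eigenvalues i = lam,
    Matrix.vecMulVec (hH.eigenvectorBasis i : ι → ℂ) (star (hH.eigenvectorBasis i : ι → ℂ))

/-- The set of distinct eigenvalues of `H`. -/
def distinctEigenvalues {H : Matrix ι ι ℂ} (hH : H.IsHermitian) : Finset ℝ :=
  Finset.univ.image hH.eigenvalues

/-- The overlap `Tr[ρ Π_lam]`. -/
def overlap {H : Matrix ι ι ℂ} (hH : H.IsHermitian) (ρ : Matrix ι ι ℂ) (lam : ℝ) : ℝ :=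
  (ρ * eigenProj hH lam).trace.re

/-- The CDF `C = H * p`, the convolution of the periodic Heaviside function with the spectral
measure `p = ∑_k p_k δ(· - τ λ_k)`; it is right-continuous because `heaviside` is. -/
def cdf {H : Matrix ι ι ℂ} (hH : H.IsHermitian) (ρ : Matrix ι ι ℂ) (τ x : ℝ) : ℝ :=
  ∑ lam ∈ distinctEigenvalues hH, overlap hH ρ lam * heaviside (x - τ * lam)

/-- What a solution `x` of the CDF inversion problem has to satisfy. -/
def Solves (δ η : ℝ) (C : ℝ → ℝ) (x : ℝ) : Prop :=
  x ∈ Set.Ioo (-(Real.pi / 3)) (Real.pi / 3) ∧ C (x + δ) > η / 2 ∧ C (x - δ) < η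

/-! ### The quantum circuit -/

/-- The time evolution `e^{-i j τ H}`. -/
def evolution (H : Matrix ι ι ℂ) (τ : ℝ) (j : ℤ) : Matrix ι ι ℂ :=
  NormedSpace.exp ((-(Complex.I * j * τ)) • H)

/-- The Hadamard gate. -/
def hadamard : Matrix (Fin 2) (Fin 2) ℂ :=
  (1 / Real.sqrt 2 : ℂ) • !![1, 1; 1, -1]

/-- The phase gate `S`. -/
def phaseGate : Matrix (Fin 2) (Fin 2) ℂ :=
  !![1, 0; 0, Complex.I]

/-- The projection `|b⟩⟨b|` of the ancilla qubit. -/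
def ketBra (b : Fin 2) : Matrix (Fin 2) (Fin 2) ℂ :=
  Matrix.single b b 1

/-- The gate `U` controlled by the ancilla qubit. -/
def controlled (U : Matrix ι ι ℂ) : Matrix (Fin 2 × ι) (Fin 2 × ι) ℂ :=
  ketBra 0 ⊗ₖ (1 : Matrix ι ι ℂ) + ketBra 1 ⊗ₖ U

/-- The circuit: Hadamard gate on the ancilla, controlled `U`, then `W` and a Hadamard gate on the
ancilla. -/
def circuit (W : Matrix (Fin 2) (Fin 2) ℂ) (U : Matrix ι ι ℂ) :
    Matrix (Fin 2 × ι) (Fin 2 × ι) ℂ :=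
  (hadamard ⊗ₖ (1 : Matrix ι ι ℂ)) * (W ⊗ₖ (1 : Matrix ι ι ℂ)) * controlled U *
    (hadamard ⊗ₖ (1 : Matrix ι ι ℂ))

/-- The probability that measuring the ancilla yields `b` after running the circuit on
`|0⟩⟨0| ⊗ ρ`. -/
def outcomeProb (W : Matrix (Fin 2) (Fin 2) ℂ) (U ρ : Matrix ι ι ℂ) (b : Fin 2) : ℝ :=
  ((ketBra b ⊗ₖ (1 : Matrix ι ι ℂ)) *
    (circuit W U * (ketBra 0 ⊗ₖ ρ) * (circuit W U)ᴴ)).trace.re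

/-- One sample: the integer `J`, and the outcomes of the circuit `e^{-i J τ H}` with `W = I` and with
`W = S†`. -/
abbrev Sample : Type := ℤ × Fin 2 × Fin 2

/-- The value `1` for outcome `0`, and `-1` for outcome `1`. -/
def signValue (b : Fin 2) : ℂ :=
  if b = 0 then 1 else -1

/-- `Z = X_J + i Y_J`. -/
def zValue (s : Sample) : ℂ :=
  signValue s.2.1 + Complex.I * signValue s.2.2

/-- The `S k` are independent, with `J` drawn from `probJ d F`, and with the two measurement outcomes
distributed, given `J = j`, as the outcomes of the circuits for `e^{-i j τ H}`. The correlation of the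
two outcomes within one sample is left free; two separate runs are a special case. -/
structure IsSampleFamily (d : ℕ) (F : ℤ → ℂ) (H ρ : Matrix ι ι ℂ) (τ : ℝ) {M : ℕ}
    {Ω : Type*} [MeasurableSpace Ω] (P : Measure Ω) (S : Fin M → Ω → Sample) : Prop where
  measurable : ∀ k, Measurable (S k)
  indep : iIndepFun S P
  law_X : ∀ k j b, P.real {ω | (S k ω).1 = j ∧ (S k ω).2.1 = b} =
    probJ d F j * outcomeProb 1 (evolution H τ j) ρ b
  law_Y : ∀ k j b, P.real {ω | (S k ω).1 = j ∧ (S k ω).2.2 = b} =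
    probJ d F j * outcomeProb phaseGateᴴ (evolution H τ j) ρ b

end Quantum

/-- The estimate `G(x; J, Z) = 𝓕 Z e^{i(θ_J + J x)}`, where `θ_j` is the argument of `F̂_j`. -/
def G (d : ℕ) (F : ℤ → ℂ) (x : ℝ) (s : Sample) : ℂ :=
  totalWeight d F * zValue s * Complex.exp (Complex.I * ((F s.1).arg + s.1 * x : ℝ))

/-! ### Classical computations with a step count

A computation returns a value and the number of elementary steps spent. The elementary steps, each of
cost one, are: a real or complex arithmetic operation, a complex exponential, taking a real part, a
comparison, reading a sample or an entry of the table of phases, and the control of one iteration of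
a loop. The programs below are written in terms of these steps only. -/

/-- A value together with the number of steps used to compute it. -/
structure Timed (α : Type) where
  val : α
  steps : ℕ

instance : Monad Timed where
  pure a := ⟨a, 0⟩
  bind m f := ⟨(f m.val).val, m.steps + (f m.val).steps⟩

namespace Timed

def add (a b : ℝ) : Timed ℝ := ⟨a + b, 1⟩
def sub (a b : ℝ) : Timed ℝ := ⟨a - b, 1⟩
def mul (a b : ℝ) : Timed ℝ := ⟨a * b, 1⟩
def div (a b : ℝ) : Timed ℝ := ⟨a / b, 1⟩
def cmul (a b : ℂ) : Timed ℂ := ⟨a * b, 1⟩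
def cexp (a : ℂ) : Timed ℂ := ⟨Complex.exp a, 1⟩
def re (a : ℂ) : Timed ℝ := ⟨a.re, 1⟩
/-- The comparison `a < b`. -/
def lt (a b : ℝ) : Timed Bool := ⟨open Classical in decide (a < b), 1⟩
/-- Read an entry of an array. -/
def read {α β : Type} (f : α → β) (a : α) : Timed β := ⟨f a, 1⟩
/-- The control of one iteration of a loop. -/
def loopControl : Timed Unit := ⟨(), 1⟩

end Timed

/-- The data that the post-processing gets besides the samples: `𝓕` and the phases `θ_j`. -/
structure Table where
  total : ℝ
  phase : ℤ → ℝ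

/-- The table that belongs to the coefficients `F`. -/
def tableOf (d : ℕ) (F : ℤ → ℂ) : Table :=
  ⟨totalWeight d F, fun j => (F j).arg⟩

/-- Evaluate the real part of `G(x; J, Z)` for one sample. -/
def evalG (tab : Table) (x : ℝ) (s : Sample) : Timed ℝ := do
  let z ← Timed.read zValue s
  let θ ← Timed.read tab.phase s.1
  let u ← Timed.mul s.1 x
  let φ ← Timed.add θ u
  let iφ ← Timed.cmul Complex.I φ
  let e ← Timed.cexp iφ
  let fz ← Timed.cmul tab.total z
  let g ← Timed.cmul fz e
  Timed.re g

theorem evalG_val (d : ℕ) (F : ℤ → ℂ) (x : ℝ) (s : Sample) :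
    (evalG (tableOf d F) x s).val = (G d F x s).re := rfl

/-- The batch average `Ḡ_r(x)`; the `k`-th member of batch `r` is the sample number `r * Ns + k`. -/
def batchMean {Nb Ns : ℕ} (tab : Table) (S : Fin (Nb * Ns) → Sample) (x : ℝ) (r : Fin Nb) :
    Timed ℝ := do
  let total ← (List.finRange Ns).foldlM (fun (acc : ℝ) (k : Fin Ns) => do
    Timed.loopControl
    let s ← Timed.read S (finProdFinEquiv (r, k))
    let g ← evalG tab x s
    Timed.add acc g) 0
  Timed.div total Ns

/-- The subroutine `CERTIFY`: the majority vote of the batches on `Ḡ_r(x) > (3/4) η`. It returns `0`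
if more than half of the batches satisfy this, and `1` otherwise. -/
def certify {Nb Ns : ℕ} (tab : Table) (η : ℝ) (S : Fin (Nb * Ns) → Sample) (x : ℝ) :
    Timed (Fin 2) := do
  let threshold ← Timed.mul (3 / 4) η
  let c ← (List.finRange Nb).foldlM (fun (c : ℝ) (r : Fin Nb) => do
    Timed.loopControl
    let g ← batchMean tab S x r
    if ← Timed.lt threshold g then Timed.add c 1 else pure c) 0
  let half ← Timed.div Nb 2
  if ← Timed.lt half c then pure 0 else pure 1

/-- The loop of `INVERT_CDF` on the current interval `[x₀, x₁]`, cut off (with value `none`) if it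
does not stop within `fuel` iterations. -/
def searchLoop {Nb Ns : ℕ} (tab : Table) (δ η : ℝ) (S : Fin (Nb * Ns) → Sample) :
    ℕ → ℝ → ℝ → Timed (Option ℝ)
  | 0, _, _ => pure none
  | fuel + 1, x₀, x₁ => do
    Timed.loopControl
    let width ← Timed.sub x₁ x₀
    let bound ← Timed.mul 2 δ
    let sum ← Timed.add x₀ x₁
    let x ← Timed.div sum 2
    if ← Timed.lt bound width then
      let u ← certify tab η S x
      let shift ← Timed.mul (2 / 3) δ
      if u = 0 then
        let y ← Timed.add x shift
        searchLoop tab δ η S fuel x₀ y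
      else
        let y ← Timed.sub x shift
        searchLoop tab δ η S fuel y x₁
    else
      pure (some x)

/-- On the samples `S` the algorithm `INVERT_CDF` stops with output `x` after `t` steps. -/
def Outputs {Nb Ns : ℕ} (tab : Table) (δ η : ℝ) (S : Fin (Nb * Ns) → Sample) (x : ℝ) (t : ℕ) :
    Prop :=
  ∃ fuel, searchLoop tab δ η S fuel (-(Real.pi / 3)) (Real.pi / 3) = ⟨some x, t⟩

/-- `f` times the `κ`-th power of its logarithm, the form of the bounds behind `Õ(f)`. -/
def polylogBound (κ : ℕ) (f : ℝ) : ℝ :=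
  f * Real.log (2 + f) ^ κ

end

end InvertCDF

open InvertCDF

namespace InvertCDF

open scoped Matrix Kronecker ComplexOrder
open MeasureTheory ProbabilityTheory

/-! ### The bump function -/

/-! On `[-1, 1]` a Chebyshev polynomial is bounded by 1, and `T_d (cosh u) = cosh (d u)` beyond it.
Hence the bump has modulus at most 1 outside the window `|x| ≤ a`, `a = 2δ/3`, while it is at least
`exp (d a / 3) / 2` on half the window (`half_exp_le_bump`). For `d` of order `δ⁻¹ log (δ⁻¹ η⁻¹)`
the normalising integral is so large that the mollifier outside the window, and its negative part,
contribute at most `η / 9`. So the smoothed step lies between the steps shifted by `±a`, up to `η /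
9`; averaging over the spectrum gives the same comparison for the CDF (`smoothCdf_le`,
`le_smoothCdf`).

The mollifier is a trigonometric polynomial of degree `d`, so the smoothed step is exactly a finite
Fourier sum, with coefficients `O(1/|j|)`; hence `𝓕 = O(log d)` (`totalWeight_le`). The two Hadamard
tests measure the real and imaginary parts of `Tr[e^{-ijτH} ρ]`, and drawing `J` in proportion to
the coefficients makes `Re G` an estimator of the smoothed CDF, with the right mean and modulus at
most `2𝓕` (`IsSampleFamily.integral_G_re_eq_smoothCdf`). Chebyshev's inequality makes one batch
inaccurate with probability at most `1/4`, and Hoeffding's inequality makes half of the batches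
inaccurate with probability at most `exp (-Nb / 8)`. If fewer than half are inaccurate, an answer 0
at `x` forces `C (x + a) > η / 2` and an answer 1 forces `C (x - a) < η`.

All iterations use the same samples, so the midpoints visited are random, and a union bound over
every possible midpoint would cost a factor exponential in the number of iterations. Monotonicity of
`C` avoids this. Moving left is harmful only where `C (x + a) ≤ η / 2`. One deterministic path of
midpoints, which moves left whenever that is permitted, separates these points from the rest: a
midpoint strictly to the right of the path may always move left. A second path does the same for
moves to the right. The invariant `Bracket` says that the search stays between the two paths, so
`CERTIFY` has to be right only on them (`exists_outputs_solves`). The union bound runs over `2n`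
fixed points with `n = O(log δ⁻¹)`, which is the source of `log log δ⁻¹` in the number of batches.
-/

theorem continuous_bump (d : ℕ) (a : ℝ) : Continuous (bump d a) := by
  unfold bump
  exact (Polynomial.continuous _).comp (by fun_prop)

theorem continuous_mollifier (d : ℕ) (a : ℝ) : Continuous (mollifier d a) := by
  unfold mollifier
  exact (continuous_bump d a).div_const _

theorem cos_le_cos_of_abs_le {x a : ℝ} (ha : |x| ≤ a) (hπ : a ≤ Real.pi) :
    Real.cos a ≤ Real.cos x := by
  rw [← Real.cos_abs x]
  exact Real.cos_le_cos_of_nonneg_of_le_pi (abs_nonneg x) hπ ha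

theorem cos_le_cos_of_le_abs {x a : ℝ} (h0 : 0 ≤ a) (ha : a ≤ |x|) (hπ : |x| ≤ Real.pi) :
    Real.cos x ≤ Real.cos a := by
  rw [← Real.cos_abs x]
  exact Real.cos_le_cos_of_nonneg_of_le_pi h0 hπ ha

/-! ### Size of the Chebyshev bump inside and outside its window. -/

section BumpBounds

variable {d : ℕ} {a : ℝ} (h0 : 0 < a) (h1 : a ≤ Real.pi / 9)

include h0 h1

theorem one_add_cos_pos : 0 < 1 + Real.cos a := by
  have : 0 < Real.cos a := Real.cos_pos_of_mem_Ioo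
    ⟨by linarith [Real.pi_pos], by linarith [Real.pi_pos]⟩
  linarith

theorem one_le_bump {x : ℝ} (hx : |x| ≤ a) : 1 ≤ bump d a x := by
  refine Polynomial.Chebyshev.one_le_eval_T_real _ ?_
  have := cos_le_cos_of_abs_le hx (by linarith [Real.pi_pos])
  have h := one_add_cos_pos h0 h1
  have : 0 ≤ 2 * (Real.cos x - Real.cos a) / (1 + Real.cos a) :=
    div_nonneg (by linarith) h.le
  linarith

theorem abs_bump_le_one {x : ℝ} (hx : a ≤ |x|) (hπ : |x| ≤ Real.pi) : |bump d a x| ≤ 1 := by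
  refine Polynomial.Chebyshev.abs_eval_T_real_le_one _ ?_
  have hc := cos_le_cos_of_le_abs h0.le hx hπ
  have h := one_add_cos_pos h0 h1
  have h2 : 2 * (Real.cos x - Real.cos a) / (1 + Real.cos a) ≤ 0 :=
    div_nonpos_of_nonpos_of_nonneg (by linarith) h.le
  have h3 : -2 ≤ 2 * (Real.cos x - Real.cos a) / (1 + Real.cos a) := by
    rw [le_div_iff₀ h]; linarith [Real.neg_one_le_cos x]
  rw [abs_le]; constructor <;> linarith

theorem neg_one_le_bump {x : ℝ} (hπ : |x| ≤ Real.pi) : -1 ≤ bump d a x := by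
  rcases le_total |x| a with h | h
  · linarith [one_le_bump (d := d) h0 h1 h]
  · exact (abs_le.1 (abs_bump_le_one h0 h1 h hπ)).1

/-- Both sides are quadratic in `a`. The left is at most `a² / 9`. With `c = cos (a / 2) ≥ 0.9` the
right is `(1 - c) (1 + 2c)`, hence at least `2.8 a² / 20`. This puts the Chebyshev argument above
`cosh (a / 3)` on the inner half of the window. -/
theorem cosh_sub_one_le_cos_half_sub_cos :
    Real.cosh (a / 3) - 1 ≤ Real.cos (a / 2) - Real.cos a := by
  have hpi := Real.pi_lt_d2
  have hpi0 := Real.pi_pos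
  have hcosh : Real.cosh (a / 3) ≤ 1 + a ^ 2 / 9 := by
    have h := Real.cosh_le_exp_half_sq (a / 3)
    have h' := Real.abs_exp_sub_one_le (x := (a / 3) ^ 2 / 2)
      (by rw [abs_of_nonneg (by positivity)]; nlinarith)
    rw [abs_of_nonneg (a := (a / 3) ^ 2 / 2) (by positivity)] at h'
    have := (abs_le.1 h').2
    nlinarith
  have hdouble : Real.cos a = 2 * Real.cos (a / 2) ^ 2 - 1 := by
    rw [← Real.cos_two_mul]; ring_nf
  have hlow : 1 - (a / 2) ^ 2 / 2 ≤ Real.cos (a / 2) := Real.one_sub_sq_div_two_le_cos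
  have hup : Real.cos (a / 2) ≤ 1 - 2 / Real.pi ^ 2 * (a / 2) ^ 2 :=
    Real.cos_le_one_sub_mul_cos_sq (by rw [abs_of_nonneg (by positivity)]; linarith)
  have hc : (0.9 : ℝ) ≤ Real.cos (a / 2) := by nlinarith
  have hpi2 : (1 / 5 : ℝ) ≤ 2 / Real.pi ^ 2 := by
    rw [div_le_div_iff₀ (by norm_num) (by positivity)]; nlinarith
  have hq : a ^ 2 / 20 ≤ 1 - Real.cos (a / 2) := by
    have := mul_le_mul_of_nonneg_right hpi2 (sq_nonneg (a / 2))
    linarith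
  have key : Real.cos (a / 2) - Real.cos a
      = (1 - Real.cos (a / 2)) * (1 + 2 * Real.cos (a / 2)) := by rw [hdouble]; ring
  rw [key]
  have : (a ^ 2 / 20) * 2.8 ≤ (1 - Real.cos (a / 2)) * (1 + 2 * Real.cos (a / 2)) :=
    mul_le_mul hq (by linarith) (by norm_num) (le_trans (by positivity) hq)
  nlinarith [sq_nonneg a]

/-- The factor `2 / (1 + cos a)` is at least 1, so the Chebyshev argument is at least `cosh (a /
3)`, and `T_d (cosh u) = cosh (d u)` turns this into exponential growth in `d a`. -/
theorem half_exp_le_bump {x : ℝ} (hx : |x| ≤ a / 2) :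
    Real.exp (d * (a / 3)) / 2 ≤ bump d a x := by
  have hpi0 := Real.pi_pos
  have hc := cos_le_cos_of_abs_le hx (by linarith)
  have hpos := one_add_cos_pos h0 h1
  have key := cosh_sub_one_le_cos_half_sub_cos h0 h1
  set y := 1 + 2 * (Real.cos x - Real.cos a) / (1 + Real.cos a) with hy
  have hle : Real.cosh (a / 3) ≤ y := by
    have hd : Real.cos x - Real.cos a ≤ 2 * (Real.cos x - Real.cos a) / (1 + Real.cos a) := by
      rw [le_div_iff₀ hpos]
      have : 0 ≤ Real.cos x - Real.cos a := by linarith [Real.one_le_cosh (a / 3)]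
      nlinarith [Real.cos_le_one a]
    linarith
  have hy1 : 1 ≤ y := (Real.one_le_cosh _).trans hle
  have hv : a / 3 ≤ Real.arcosh y := by
    rw [← Real.arcosh_cosh (x := a / 3) (by positivity)]
    exact (Real.arcosh_le_arcosh (Real.cosh_pos _) (by linarith)).2 hle
  have hb : bump d a x = Real.cosh (d * Real.arcosh y) := by
    have := Polynomial.Chebyshev.T_real_cosh (Real.arcosh y) d
    rw [Real.cosh_arcosh hy1] at this
    simpa [bump] using this
  rw [hb]
  have hmono : Real.cosh (d * (a / 3)) ≤ Real.cosh (d * Real.arcosh y) := by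
    rw [Real.cosh_le_cosh, abs_of_nonneg (by positivity), abs_of_nonneg]
    · gcongr
    · exact mul_nonneg (by positivity) (le_trans (by positivity) hv)
  refine le_trans ?_ hmono
  rw [Real.cosh_eq]
  linarith [Real.exp_pos (-(d * (a / 3)))]

/-- The inner half of the window has length `a` and carries the exponential; the rest of the period
loses at most its length, since the bump is at least `-1`. -/
theorem integral_bump_ge :
    a * (Real.exp (d * (a / 3)) / 2) - 2 * Real.pi ≤ ∫ y in (-Real.pi)..Real.pi, bump d a y := by
  have hpi0 := Real.pi_pos
  have hint : ∀ u v, IntervalIntegrable (bump d a) volume u v :=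
    fun u v => (continuous_bump d a).intervalIntegrable u v
  rw [← intervalIntegral.integral_add_adjacent_intervals (hint (-Real.pi) (-(a / 2)))
      (hint (-(a / 2)) Real.pi),
    ← intervalIntegral.integral_add_adjacent_intervals (hint (-(a / 2)) (a / 2))
      (hint (a / 2) Real.pi)]
  have hA : ∫ _ in (-Real.pi)..(-(a / 2)), (-1 : ℝ) ≤ ∫ y in (-Real.pi)..(-(a / 2)), bump d a y :=
    intervalIntegral.integral_mono_on (by linarith) (by simp) (hint _ _) fun x hx =>
      neg_one_le_bump h0 h1 (abs_le.2 ⟨hx.1, by linarith [hx.2]⟩)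
  have hC : ∫ _ in (a / 2)..Real.pi, (-1 : ℝ) ≤ ∫ y in (a / 2)..Real.pi, bump d a y :=
    intervalIntegral.integral_mono_on (by linarith) (by simp) (hint _ _) fun x hx =>
      neg_one_le_bump h0 h1 (abs_le.2 ⟨by linarith [hx.1], hx.2⟩)
  have hB : ∫ _ in (-(a / 2))..(a / 2), (Real.exp (d * (a / 3)) / 2)
      ≤ ∫ y in (-(a / 2))..(a / 2), bump d a y :=
    intervalIntegral.integral_mono_on (by linarith) (by simp) (hint _ _) fun x hx =>
      half_exp_le_bump h0 h1 (abs_le.2 ⟨hx.1, hx.2⟩)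
  rw [intervalIntegral.integral_const, smul_eq_mul] at hA hB hC
  linarith

/-- From `b ≥ -1` follows `|b| ≤ b + 2`. After normalisation this keeps the `L¹` norm of the
mollifier close to 1. -/
theorem integral_abs_bump_le :
    ∫ y in (-Real.pi)..Real.pi, |bump d a y|
      ≤ (∫ y in (-Real.pi)..Real.pi, bump d a y) + 4 * Real.pi := by
  have hpi0 := Real.pi_pos
  have hcont := continuous_bump d a
  have : ∫ y in (-Real.pi)..Real.pi, |bump d a y|
      ≤ ∫ y in (-Real.pi)..Real.pi, (bump d a y + 2) :=
    intervalIntegral.integral_mono_on (by linarith) (hcont.abs.intervalIntegrable _ _)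
      ((hcont.add continuous_const).intervalIntegrable _ _) fun x hx => by
        have := neg_one_le_bump (d := d) h0 h1 (abs_le.2 ⟨hx.1, hx.2⟩)
        rw [abs_le]; constructor <;> linarith
  rw [intervalIntegral.integral_add (hcont.intervalIntegrable _ _) (by simp),
    intervalIntegral.integral_const, smul_eq_mul] at this
  linarith

end BumpBounds

/-! ### The approximate Heaviside function -/

theorem heaviside_nonneg (x : ℝ) : 0 ≤ heaviside x := by
  unfold heaviside; split_ifs <;> norm_num

theorem heaviside_le_one (x : ℝ) : heaviside x ≤ 1 := by
  unfold heaviside; split_ifs <;> norm_num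

theorem heaviside_of_nonneg {x : ℝ} (h : 0 ≤ x) (hx : x < Real.pi) : heaviside x = 1 :=
  if_pos ⟨0, by simpa using h, by simpa using hx⟩

theorem heaviside_of_neg {x : ℝ} (h : -Real.pi ≤ x) (hx : x < 0) : heaviside x = 0 := by
  refine if_neg ?_
  rintro ⟨k, h1, h2⟩
  have hpi := Real.pi_pos
  have hk : (k : ℝ) < 0 := by
    by_contra hk
    have : 0 ≤ 2 * (k : ℝ) * Real.pi := mul_nonneg (by linarith) hpi.le
    linarith
  have hk' : k ≤ -1 := by
    have : k < 0 := by exact_mod_cast hk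
    omega
  have hk'' : (k : ℝ) ≤ -1 := by exact_mod_cast hk'
  nlinarith

theorem heaviside_periodic : Function.Periodic heaviside (2 * Real.pi) := by
  intro x
  unfold heaviside
  congr 1
  refine propext ⟨?_, ?_⟩
  · rintro ⟨k, h1, h2⟩
    exact ⟨k - 1, by push_cast; linarith, by push_cast; linarith⟩
  · rintro ⟨k, h1, h2⟩
    exact ⟨k + 1, by push_cast; linarith, by push_cast; linarith⟩

theorem measurable_heaviside : Measurable heaviside := by
  unfold heaviside
  refine Measurable.ite ?_ measurable_const measurable_const
  have : {x : ℝ | ∃ k : ℤ, 2 * k * Real.pi ≤ x ∧ x < (2 * k + 1) * Real.pi}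
      = ⋃ k : ℤ, Set.Ico (2 * k * Real.pi) ((2 * k + 1) * Real.pi) := by
    ext x; simp
  rw [this]
  exact MeasurableSet.iUnion fun k => measurableSet_Ico

theorem intervalIntegrable_mul_heaviside {f : ℝ → ℝ} (hf : Continuous f) (x u v : ℝ) :
    IntervalIntegrable (fun y => f y * heaviside (x - y)) volume u v := by
  rw [intervalIntegrable_iff]
  refine Integrable.mul_bdd (c := 1) (intervalIntegrable_iff.1 (hf.intervalIntegrable u v)) ?_ ?_
  · exact (measurable_heaviside.comp (measurable_const.sub measurable_id)).aestronglyMeasurable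
  · refine ae_of_all _ fun y => ?_
    rw [Real.norm_eq_abs, abs_of_nonneg (heaviside_nonneg _)]
    exact heaviside_le_one _

/-! ### Comparison of the smoothed step with the shifted sharp steps. -/

section HeavisideBounds

variable {d : ℕ} {a ε : ℝ} (h0 : 0 < a) (h1 : a ≤ Real.pi / 9)
  (hN : 0 < ∫ y in (-Real.pi)..Real.pi, bump d a y)
  (hε : 2 * Real.pi / (∫ y in (-Real.pi)..Real.pi, bump d a y) ≤ ε)

include hN in
theorem integral_mollifier : ∫ y in (-Real.pi)..Real.pi, mollifier d a y = 1 := by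
  unfold mollifier
  rw [intervalIntegral.integral_div, div_self hN.ne']

include h0 h1 hN in
theorem integral_abs_mollifier_le :
    ∫ y in (-Real.pi)..Real.pi, |mollifier d a y|
      ≤ 1 + 2 * (2 * Real.pi / (∫ y in (-Real.pi)..Real.pi, bump d a y)) := by
  have : ∀ y, |mollifier d a y| = |bump d a y| / ∫ y in (-Real.pi)..Real.pi, bump d a y :=
    fun y => by rw [mollifier, abs_div, abs_of_pos hN]
  simp_rw [this]
  rw [intervalIntegral.integral_div, div_le_iff₀ hN]
  have := integral_abs_bump_le (d := d) h0 h1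
  have h2 : (1 + 2 * (2 * Real.pi / (∫ y in (-Real.pi)..Real.pi, bump d a y)))
      * (∫ y in (-Real.pi)..Real.pi, bump d a y)
      = (∫ y in (-Real.pi)..Real.pi, bump d a y) + 4 * Real.pi := by
    field_simp; ring
  linarith

include hN in
-- The kernel has integral 1, so bounds on the defect from 1 follow from the same estimates of the
-- integrand as bounds on the value itself.
theorem one_sub_approxHeaviside (x : ℝ) : 1 - approxHeaviside d a x
    = ∫ y in (-Real.pi)..Real.pi, mollifier d a y * (1 - heaviside (x - y)) := by
  have hc := continuous_mollifier d a
  simp_rw [mul_sub, mul_one]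
  rw [intervalIntegral.integral_sub (hc.intervalIntegrable _ _)
    (intervalIntegrable_mul_heaviside hc x _ _), integral_mollifier hN, approxHeaviside]

include h0 h1 hN in
theorem neg_le_mollifier {y : ℝ} (hy : y ∈ Set.Icc (-Real.pi) Real.pi) :
    -(1 / ∫ y in (-Real.pi)..Real.pi, bump d a y) ≤ mollifier d a y := by
  rw [mollifier, ← neg_div]
  exact div_le_div_of_nonneg_right (neg_one_le_bump h0 h1 (abs_le.2 hy)) hN.le

include h0 h1 hN in
theorem mollifier_le {y : ℝ} (hy : y ∈ Set.Icc (-Real.pi) Real.pi) (ha : a ≤ |y|) :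
    mollifier d a y ≤ 1 / ∫ y in (-Real.pi)..Real.pi, bump d a y := by
  rw [mollifier]
  exact div_le_div_of_nonneg_right
    (abs_le.1 (abs_bump_le_one h0 h1 ha (abs_le.2 hy))).2 hN.le

theorem integral_const_period (c : ℝ) :
    ∫ _ in (-Real.pi)..Real.pi, c = 2 * Real.pi * c := by
  rw [intervalIntegral.integral_const, smul_eq_mul]; ring

include h0 h1 hN hε in
-- Only the negative part of the kernel, at most the inverse of the normalising integral at each
-- point, can push the convolution below 0.
theorem neg_le_approxHeaviside (x : ℝ) : -ε ≤ approxHeaviside d a x := by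
  have hpi0 := Real.pi_pos
  have hc := continuous_mollifier d a
  have : ∫ _ in (-Real.pi)..Real.pi, -(1 / ∫ y in (-Real.pi)..Real.pi, bump d a y)
      ≤ approxHeaviside d a x := by
    refine intervalIntegral.integral_mono_on (by linarith) (by simp)
      (intervalIntegrable_mul_heaviside hc x _ _) fun y hy => ?_
    have h := neg_le_mollifier (d := d) h0 h1 hN hy
    have hp : 0 < 1 / ∫ y in (-Real.pi)..Real.pi, bump d a y := by positivity
    nlinarith [heaviside_nonneg (x - y), heaviside_le_one (x - y)]
  rw [integral_const_period] at this
  refine le_trans ?_ this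
  rw [mul_neg, mul_one_div]
  linarith

include h0 h1 hN hε in
theorem approxHeaviside_le (x : ℝ) : approxHeaviside d a x ≤ 1 + ε := by
  have hpi0 := Real.pi_pos
  have hc := continuous_mollifier d a
  have : ∫ _ in (-Real.pi)..Real.pi, -(1 / ∫ y in (-Real.pi)..Real.pi, bump d a y)
      ≤ 1 - approxHeaviside d a x := by
    rw [one_sub_approxHeaviside hN]
    refine intervalIntegral.integral_mono_on (by linarith) (by simp) ?_ fun y hy => ?_
    · simp_rw [mul_sub, mul_one]
      exact (hc.intervalIntegrable _ _).sub (intervalIntegrable_mul_heaviside hc x _ _)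
    have h := neg_le_mollifier (d := d) h0 h1 hN hy
    have hp : 0 < 1 / ∫ y in (-Real.pi)..Real.pi, bump d a y := by positivity
    nlinarith [heaviside_nonneg (x - y), heaviside_le_one (x - y)]
  rw [integral_const_period, mul_neg, mul_one_div] at this
  linarith

include h0 h1 hN hε in
-- For `|y| ≤ a` the step at `x - y` already equals 1, so the defect comes from the tails of the
-- kernel only.
theorem one_sub_le_approxHeaviside {x : ℝ} (hx : a ≤ x) (hx' : x < Real.pi - a) :
    1 - ε ≤ approxHeaviside d a x := by
  have hpi0 := Real.pi_pos
  have hc := continuous_mollifier d a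
  have : 1 - approxHeaviside d a x
      ≤ ∫ _ in (-Real.pi)..Real.pi, (1 / ∫ y in (-Real.pi)..Real.pi, bump d a y) := by
    rw [one_sub_approxHeaviside hN]
    refine intervalIntegral.integral_mono_on (by linarith) ?_ (by simp) fun y hy => ?_
    · simp_rw [mul_sub, mul_one]
      exact (hc.intervalIntegrable _ _).sub (intervalIntegrable_mul_heaviside hc x _ _)
    have hp : 0 < 1 / ∫ y in (-Real.pi)..Real.pi, bump d a y := by positivity
    rcases le_total |y| a with h | h
    · have h' := abs_le.1 h
      rw [heaviside_of_nonneg (by linarith) (by linarith)]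
      simpa using hp.le
    · have h' := mollifier_le (d := d) h0 h1 hN hy h
      nlinarith [heaviside_nonneg (x - y), heaviside_le_one (x - y)]
  rw [integral_const_period, mul_one_div] at this
  linarith

include h0 h1 hN hε in
theorem approxHeaviside_le_of_neg {x : ℝ} (hx : -Real.pi + a ≤ x) (hx' : x < -a) :
    approxHeaviside d a x ≤ ε := by
  have hpi0 := Real.pi_pos
  have hc := continuous_mollifier d a
  have : approxHeaviside d a x
      ≤ ∫ _ in (-Real.pi)..Real.pi, (1 / ∫ y in (-Real.pi)..Real.pi, bump d a y) := by
    refine intervalIntegral.integral_mono_on (by linarith)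
      (intervalIntegrable_mul_heaviside hc x _ _) (by simp) fun y hy => ?_
    have hp : 0 < 1 / ∫ y in (-Real.pi)..Real.pi, bump d a y := by positivity
    rcases le_total |y| a with h | h
    · have h' := abs_le.1 h
      rw [heaviside_of_neg (by linarith) (by linarith)]
      simpa using hp.le
    · have h' := mollifier_le (d := d) h0 h1 hN hy h
      nlinarith [heaviside_nonneg (x - y), heaviside_le_one (x - y)]
  rw [integral_const_period, mul_one_div] at this
  linarith

include h0 h1 hN hε in
-- The shifted step jumps at `-a`: to the left of it the tail bound applies, to the right the
-- overshoot bound. The restriction on `x`, with `a ≤ π / 9`, keeps the arguments clear of the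
-- downward jumps at `±π`.
theorem approxHeaviside_le_heaviside_add {x : ℝ} (hx : |x| < 2 * Real.pi / 3) :
    approxHeaviside d a x ≤ heaviside (x + a) + ε := by
  have hx' := abs_lt.1 hx
  have hpi0 := Real.pi_pos
  rcases lt_or_ge x (-a) with h | h
  · rw [heaviside_of_neg (by linarith) (by linarith)]
    linarith [approxHeaviside_le_of_neg (d := d) h0 h1 hN hε (x := x) (by linarith) h]
  · rw [heaviside_of_nonneg (by linarith) (by linarith)]
    exact approxHeaviside_le h0 h1 hN hε x

include h0 h1 hN hε in
theorem heaviside_sub_le_approxHeaviside {x : ℝ} (hx : |x| < 2 * Real.pi / 3) :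
    heaviside (x - a) - ε ≤ approxHeaviside d a x := by
  have hx' := abs_lt.1 hx
  have hpi0 := Real.pi_pos
  rcases lt_or_ge x a with h | h
  · rw [heaviside_of_neg (by linarith) (by linarith)]
    linarith [neg_le_approxHeaviside (d := d) h0 h1 hN hε x]
  · rw [heaviside_of_nonneg (by linarith) (by linarith)]
    exact one_sub_le_approxHeaviside h0 h1 hN hε h (by linarith)

end HeavisideBounds

/-! ### Trigonometric polynomials -/

/-- The character `x ↦ e^{ijx}`. -/
noncomputable def character (j : ℤ) (x : ℝ) : ℂ := Complex.exp (Complex.I * j * x)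

theorem continuous_character (j : ℤ) : Continuous (character j) := by
  unfold character; fun_prop

theorem norm_character (j : ℤ) (x : ℝ) : ‖character j x‖ = 1 := by
  have : Complex.I * j * x = ((j * x : ℝ) : ℂ) * Complex.I := by push_cast; ring
  rw [character, this, Complex.norm_exp_ofReal_mul_I]

theorem character_add (j : ℤ) (x y : ℝ) : character j (x + y) = character j x * character j y := by
  rw [character, character, character, ← Complex.exp_add]; push_cast; ring_nf

theorem character_mul (j k : ℤ) (x : ℝ) : character j x * character k x = character (j + k) x := by
  rw [character, character, character, ← Complex.exp_add]; push_cast; ring_nf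

theorem character_zero (x : ℝ) : character 0 x = 1 := by simp [character]

theorem character_periodic (j : ℤ) : Function.Periodic (character j) (2 * Real.pi) := by
  intro x
  have : Complex.I * j * (2 * Real.pi) = j * (2 * Real.pi * Complex.I) := by ring
  rw [character_add, character, character]
  push_cast
  rw [this, Complex.exp_int_mul_two_pi_mul_I, mul_one]

theorem integral_character (j : ℤ) :
    ∫ x in (-Real.pi)..Real.pi, character j x = if j = 0 then (2 * Real.pi : ℂ) else 0 := by
  split_ifs with h
  · subst h
    simp only [character_zero]
    rw [intervalIntegral.integral_const, Complex.real_smul]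
    push_cast; ring
  · have hc : Complex.I * j ≠ 0 := mul_ne_zero Complex.I_ne_zero (by exact_mod_cast h)
    unfold character
    rw [integral_exp_mul_complex hc]
    have h1 := character_periodic j (-Real.pi)
    have h2 : -Real.pi + 2 * Real.pi = Real.pi := by ring
    rw [h2] at h1
    unfold character at h1
    rw [h1, sub_self, zero_div]

/-- The space of trigonometric polynomials of degree at most `d`. -/
noncomputable def trigPoly (d : ℕ) : Submodule ℂ (ℝ → ℂ) :=
  Submodule.span ℂ (character '' (Finset.Icc (-(d : ℤ)) d : Finset ℤ))

theorem character_mem_trigPoly {d : ℕ} {j : ℤ} (h : |j| ≤ d) : character j ∈ trigPoly d :=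
  Submodule.subset_span ⟨j, by simpa using abs_le.1 h, rfl⟩

theorem trigPoly_mono {d e : ℕ} (h : d ≤ e) : trigPoly d ≤ trigPoly e := by
  refine Submodule.span_mono (Set.image_mono ?_)
  intro j hj
  simp only [Finset.coe_Icc, Set.mem_Icc] at hj ⊢
  omega

theorem exists_coeff_of_mem_trigPoly {d : ℕ} {f : ℝ → ℂ} (hf : f ∈ trigPoly d) :
    ∃ c : ℤ → ℂ, ∀ x, f x = ∑ j ∈ Finset.Icc (-(d : ℤ)) d, c j * character j x := by
  obtain ⟨c, hc⟩ := (Submodule.mem_span_image_finset_iff_exists_fun ℂ).1 hf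
  refine ⟨fun j => if h : j ∈ Finset.Icc (-(d : ℤ)) d then c ⟨j, h⟩ else 0, fun x => ?_⟩
  rw [← hc, Finset.sum_apply, ← Finset.sum_coe_sort (Finset.Icc (-(d : ℤ)) d)]
  refine Finset.sum_congr rfl fun j _ => ?_
  simp only [dif_pos j.2, Subtype.coe_eta]
  rfl

/-- Multiplication by the cosine sends the character of index `j` to the average of those of index
`j + 1` and `j - 1`. -/
theorem cos_mul_mem_trigPoly {d : ℕ} {f : ℝ → ℂ} (hf : f ∈ trigPoly d) :
    (fun x => (Real.cos x : ℂ)) * f ∈ trigPoly (d + 1) := by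
  unfold trigPoly at hf
  induction hf using Submodule.span_induction with
  | mem f hf =>
    obtain ⟨j, hj, rfl⟩ := hf
    have : (fun x => (Real.cos x : ℂ)) * character j
        = (1 / 2 : ℂ) • character (j + 1) + (1 / 2 : ℂ) • character (j - 1) := by
      funext x
      simp only [Pi.mul_apply, Pi.add_apply, Pi.smul_apply, smul_eq_mul]
      rw [sub_eq_add_neg, ← character_mul, ← character_mul]
      have h1 : character 1 x = Complex.exp (x * Complex.I) := by
        rw [character]; congr 1; push_cast; ring
      have h2 : character (-1) x = Complex.exp (-x * Complex.I) := by
        rw [character]; congr 1; push_cast; ring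
      rw [h1, h2, Complex.ofReal_cos, Complex.cos]
      ring
    rw [this]
    simp only [Finset.coe_Icc, Set.mem_Icc] at hj
    refine Submodule.add_mem _ (Submodule.smul_mem _ _ (character_mem_trigPoly ?_))
      (Submodule.smul_mem _ _ (character_mem_trigPoly ?_)) <;>
    · rw [abs_le]; push_cast; omega
  | zero => rw [mul_zero]; exact Submodule.zero_mem _
  | add f g _ _ hf hg => rw [mul_add]; exact Submodule.add_mem _ hf hg
  | smul a f _ hf => rw [mul_smul_comm]; exact Submodule.smul_mem _ _ hf

theorem cos_pow_mem_trigPoly (k : ℕ) : (fun x => (Real.cos x : ℂ)) ^ k ∈ trigPoly k := by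
  induction k with
  | zero =>
    rw [pow_zero]
    have : (1 : ℝ → ℂ) = character 0 := by funext x; rw [character_zero]; rfl
    rw [this]
    exact character_mem_trigPoly (by simp)
  | succ k ih => rw [pow_succ']; exact cos_mul_mem_trigPoly ih

theorem eval_cos_mem_trigPoly {d : ℕ} {p : Polynomial ℝ} (hp : p.natDegree ≤ d) :
    (fun x => ((p.eval (Real.cos x) : ℝ) : ℂ)) ∈ trigPoly d := by
  have : (fun x => ((p.eval (Real.cos x) : ℝ) : ℂ))
      = ∑ k ∈ Finset.range (d + 1), (p.coeff k : ℂ) • (fun x => (Real.cos x : ℂ)) ^ k := by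
    funext x
    rw [Polynomial.eval_eq_sum_range' (Nat.lt_succ_of_le hp), Finset.sum_apply]
    push_cast
    rfl
  rw [this]
  refine Submodule.sum_mem _ fun k hk => Submodule.smul_mem _ _ ?_
  exact trigPoly_mono (Nat.lt_succ_iff.1 (Finset.mem_range.1 hk)) (cos_pow_mem_trigPoly k)

/-- The argument of the Chebyshev polynomial is affine in `cos x`, so the mollifier is a polynomial
of degree at most `d` in `cos x`. No Fourier tail has to be truncated later. -/
theorem mollifier_mem_trigPoly (d : ℕ) (a : ℝ) :
    (fun x => (mollifier d a x : ℂ)) ∈ trigPoly d := by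
  set N := ∫ y in (-Real.pi)..Real.pi, bump d a y
  set B := 2 / (1 + Real.cos a)
  set q : Polynomial ℝ := Polynomial.C (1 / N) * (Polynomial.Chebyshev.T ℝ d).comp
    (Polynomial.C (1 - B * Real.cos a) + Polynomial.C B * Polynomial.X) with hq
  have hdeg : q.natDegree ≤ d := by
    refine (Polynomial.natDegree_C_mul_le _ _).trans (Polynomial.natDegree_comp_le.trans ?_)
    rw [Polynomial.Chebyshev.natDegree_T]
    have : (Polynomial.C (1 - B * Real.cos a) + Polynomial.C B * Polynomial.X).natDegree ≤ 1 := by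
      compute_degree
    simpa using Nat.mul_le_mul_left d this
  have : (fun x => (mollifier d a x : ℂ)) = fun x => ((q.eval (Real.cos x) : ℝ) : ℂ) := by
    funext x
    congr 1
    rw [hq, Polynomial.eval_mul, Polynomial.eval_comp, Polynomial.eval_C, mollifier, bump]
    simp only [Polynomial.eval_add, Polynomial.eval_mul, Polynomial.eval_C, Polynomial.eval_X]
    rw [div_eq_mul_one_div, mul_comm]
    congr 2
    simp only [B]
    ring
  rw [this]
  exact eval_cos_mem_trigPoly hdeg

/-! ### Fourier coefficients of the approximate Heaviside function -/

/-- The `j`-th Fourier integral of the periodic Heaviside function. -/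
noncomputable def heavisideIntegral (j : ℤ) : ℂ := ∫ x in (0 : ℝ)..Real.pi, character (-j) x

theorem norm_heavisideIntegral_le {j : ℤ} (hj : j ≠ 0) :
    ‖heavisideIntegral j‖ ≤ 2 / |(j : ℝ)| := by
  have hj' : (j : ℂ) ≠ 0 := by exact_mod_cast hj
  have hc : Complex.I * ((-j : ℤ) : ℂ) ≠ 0 :=
    mul_ne_zero Complex.I_ne_zero (by push_cast; exact neg_ne_zero.2 hj')
  have h : heavisideIntegral j
      = (character (-j) Real.pi - character (-j) 0) / (Complex.I * ((-j : ℤ) : ℂ)) := by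
    unfold heavisideIntegral character
    rw [integral_exp_mul_complex hc]
  rw [h, norm_div]
  have h1 : ‖Complex.I * ((-j : ℤ) : ℂ)‖ = |(j : ℝ)| := by
    rw [norm_mul, Complex.norm_I, one_mul, Complex.norm_intCast]; push_cast; rw [abs_neg]
  rw [h1]
  gcongr
  refine (norm_sub_le _ _).trans ?_
  rw [norm_character, norm_character]; norm_num

theorem norm_heavisideIntegral_zero_le : ‖heavisideIntegral 0‖ ≤ Real.pi := by
  unfold heavisideIntegral
  simp only [neg_zero, character_zero]
  rw [intervalIntegral.integral_const, Complex.real_smul, mul_one, Complex.norm_real, sub_zero,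
    Real.norm_eq_abs, abs_of_pos Real.pi_pos]

/-- Characters are eigenfunctions of convolution over a period. Writing the character at `y` as its
value at `x` times the conjugate character at `x - y` leaves an integral that does not depend on
`x`. -/
theorem integral_character_mul_heaviside (j : ℤ) (x : ℝ) :
    ∫ y in (-Real.pi)..Real.pi, character j y * (heaviside (x - y) : ℂ)
      = heavisideIntegral j * character j x := by
  have hpi := Real.pi_pos
  have h1 : ∀ y, character j y * (heaviside (x - y) : ℂ)
      = character j x * ((fun u => character (-j) u * (heaviside u : ℂ)) (x - y)) := by
    intro y
    have : character j y = character j x * character (-j) (x - y) := by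
      rw [character, character, character, ← Complex.exp_add]; push_cast; ring_nf
    simp only
    rw [this]; ring
  have hper : Function.Periodic (fun u => character (-j) u * (heaviside u : ℂ)) (2 * Real.pi) := by
    intro u
    simp only
    rw [character_periodic, heaviside_periodic]
  have hmeas : IntervalIntegrable (fun u => character (-j) u * (heaviside u : ℂ)) volume
      (-Real.pi) Real.pi := by
    rw [intervalIntegrable_iff]
    refine Integrable.mul_bdd (c := 1)
      (intervalIntegrable_iff.1 ((continuous_character _).intervalIntegrable _ _)) ?_ ?_
    · exact (Complex.measurable_ofReal.comp measurable_heaviside).aestronglyMeasurable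
    · refine ae_of_all _ fun y => ?_
      rw [Complex.norm_real, Real.norm_eq_abs, abs_of_nonneg (heaviside_nonneg _)]
      exact heaviside_le_one _
  simp_rw [h1]
  rw [intervalIntegral.integral_const_mul, mul_comm]
  congr 1
  rw [intervalIntegral.integral_comp_sub_left (fun u => character (-j) u * (heaviside u : ℂ))]
  -- The substitution moved the period of integration; periodicity moves it back to `[-π, π]`.
  have h2 := hper.intervalIntegral_add_eq (x - Real.pi) (-Real.pi)
  rw [show x - Real.pi + 2 * Real.pi = x - -Real.pi by ring,
    show -Real.pi + 2 * Real.pi = Real.pi by ring] at h2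
  rw [h2, ← intervalIntegral.integral_add_adjacent_intervals (b := 0)
    (hmeas.mono_set (Set.uIcc_subset_uIcc Set.left_mem_uIcc
      (by rw [Set.uIcc_of_le (by linarith)]; exact ⟨by linarith, hpi.le⟩)))
    (hmeas.mono_set (Set.uIcc_subset_uIcc
      (by rw [Set.uIcc_of_le (by linarith)]; exact ⟨by linarith, hpi.le⟩) Set.right_mem_uIcc))]
  have h3 : ∫ u in (-Real.pi)..0, character (-j) u * (heaviside u : ℂ) = 0 := by
    rw [intervalIntegral.integral_of_le (by linarith), integral_Ioc_eq_integral_Ioo]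
    rw [setIntegral_congr_fun (g := fun _ => 0) measurableSet_Ioo]
    · simp
    · intro u hu
      simp only
      rw [heaviside_of_neg hu.1.le hu.2]; simp
  have h4 : ∫ u in (0 : ℝ)..Real.pi, character (-j) u * (heaviside u : ℂ)
      = heavisideIntegral j := by
    unfold heavisideIntegral
    rw [intervalIntegral.integral_of_le hpi.le, intervalIntegral.integral_of_le hpi.le,
      integral_Ioc_eq_integral_Ioo, integral_Ioc_eq_integral_Ioo]
    refine setIntegral_congr_fun measurableSet_Ioo fun u hu => ?_
    rw [heaviside_of_nonneg hu.1.le hu.2]; simp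
  rw [h3, h4, zero_add]

theorem intervalIntegrable_character_mul_heaviside (j : ℤ) (x u v : ℝ) :
    IntervalIntegrable (fun y => character j y * (heaviside (x - y) : ℂ)) volume u v := by
  rw [intervalIntegrable_iff]
  refine Integrable.mul_bdd (c := 1)
    (intervalIntegrable_iff.1 ((continuous_character _).intervalIntegrable _ _)) ?_ ?_
  · exact (Complex.measurable_ofReal.comp (measurable_heaviside.comp
      (measurable_const.sub measurable_id))).aestronglyMeasurable
  · refine ae_of_all _ fun y => ?_
    rw [Complex.norm_real, Real.norm_eq_abs, abs_of_nonneg (heaviside_nonneg _)]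
    exact heaviside_le_one _

theorem fourierIntegral_sum_character {d : ℕ} (c : ℤ → ℂ) {j : ℤ}
    (hj : j ∈ Finset.Icc (-(d : ℤ)) d) :
    ∫ x in (-Real.pi)..Real.pi,
      (∑ k ∈ Finset.Icc (-(d : ℤ)) d, c k * character k x) * character (-j) x
      = 2 * Real.pi * c j := by
  have : ∀ x, (∑ k ∈ Finset.Icc (-(d : ℤ)) d, c k * character k x) * character (-j) x
      = ∑ k ∈ Finset.Icc (-(d : ℤ)) d, c k * character (k + -j) x := by
    intro x
    rw [Finset.sum_mul]
    exact Finset.sum_congr rfl fun k _ => by rw [mul_assoc, character_mul]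
  simp_rw [this]
  rw [intervalIntegral.integral_finsetSum fun k _ =>
    ((continuous_character _).const_mul (c k)).intervalIntegrable _ _]
  simp_rw [intervalIntegral.integral_const_mul, integral_character]
  rw [Finset.sum_eq_single_of_mem j hj]
  · simp; ring
  · intro k _ hk
    rw [if_neg (by omega), mul_zero]

theorem approxHeaviside_eq_sum {d : ℕ} {a : ℝ} {m : ℤ → ℂ}
    (hm : ∀ x, (mollifier d a x : ℂ) = ∑ j ∈ Finset.Icc (-(d : ℤ)) d, m j * character j x) (x : ℝ) :
    (approxHeaviside d a x : ℂ)
      = ∑ j ∈ Finset.Icc (-(d : ℤ)) d, m j * heavisideIntegral j * character j x := by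
  unfold approxHeaviside
  rw [← intervalIntegral.integral_ofReal]
  have : ∀ y, ((mollifier d a y * heaviside (x - y) : ℝ) : ℂ)
      = ∑ j ∈ Finset.Icc (-(d : ℤ)) d, m j * (character j y * (heaviside (x - y) : ℂ)) := by
    intro y
    push_cast
    rw [hm, Finset.sum_mul]
    exact Finset.sum_congr rfl fun j _ => mul_assoc _ _ _
  simp_rw [this]
  rw [intervalIntegral.integral_finsetSum fun j _ =>
    (intervalIntegrable_character_mul_heaviside j x _ _).const_mul (m j)]
  refine Finset.sum_congr rfl fun j _ => ?_
  rw [intervalIntegral.integral_const_mul, integral_character_mul_heaviside, mul_assoc]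

theorem character_neg_eq (j : ℤ) (x : ℝ) :
    Complex.exp (-(Complex.I * j * x)) = character (-j) x := by
  rw [character]; push_cast; ring_nf

theorem coeff_eq {d : ℕ} {a : ℝ} {m : ℤ → ℂ}
    (hm : ∀ x, (mollifier d a x : ℂ) = ∑ j ∈ Finset.Icc (-(d : ℤ)) d, m j * character j x)
    {j : ℤ} (hj : j ∈ Finset.Icc (-(d : ℤ)) d) : coeff d a j = m j * heavisideIntegral j := by
  have hpi : (Real.pi : ℂ) ≠ 0 := by exact_mod_cast Real.pi_ne_zero
  unfold coeff
  simp_rw [character_neg_eq, approxHeaviside_eq_sum hm]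
  rw [fourierIntegral_sum_character (fun k => m k * heavisideIntegral k) hj]
  field_simp

/-- The approximate Heaviside function is the sum of its Fourier series. -/
theorem approxHeaviside_eq_sum_coeff (d : ℕ) (a x : ℝ) : (approxHeaviside d a x : ℂ)
    = ∑ j ∈ Finset.Icc (-(d : ℤ)) d, coeff d a j * character j x := by
  obtain ⟨m, hm⟩ := exists_coeff_of_mem_trigPoly (mollifier_mem_trigPoly d a)
  rw [approxHeaviside_eq_sum hm]
  exact Finset.sum_congr rfl fun j hj => by rw [coeff_eq hm hj]

/-- The coefficient factors into one of the mollifier and a Fourier integral of the step. The first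
factor is at most the `L¹` norm of the mollifier over `2π`. -/
theorem norm_coeff_le (d : ℕ) (a : ℝ) {A : ℝ}
    (hA : ∫ y in (-Real.pi)..Real.pi, |mollifier d a y| ≤ A) {j : ℤ}
    (hj : j ∈ Finset.Icc (-(d : ℤ)) d) :
    ‖coeff d a j‖ ≤ A / (2 * Real.pi) * ‖heavisideIntegral j‖ := by
  have hpi := Real.pi_pos
  obtain ⟨m, hm⟩ := exists_coeff_of_mem_trigPoly (mollifier_mem_trigPoly d a)
  rw [coeff_eq hm hj, norm_mul]
  gcongr
  rw [le_div_iff₀ (by positivity)]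
  have h := fourierIntegral_sum_character m hj
  simp_rw [← hm] at h
  have h' : ‖m j‖ * (2 * Real.pi) = ‖2 * (Real.pi : ℂ) * m j‖ := by
    rw [norm_mul, norm_mul, Complex.norm_real, Real.norm_eq_abs, abs_of_pos hpi,
      Complex.norm_ofNat, mul_comm]
  rw [h', ← h]
  refine (intervalIntegral.norm_integral_le_integral_norm (by linarith)).trans ?_
  simp_rw [norm_mul, norm_character, mul_one, Complex.norm_real, Real.norm_eq_abs]
  exact hA

/-- The sum is `1` plus twice a harmonic number. The value 1 at `j = 0` is the bound that
`totalWeight_le` has for the constant coefficient. -/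
theorem sum_inv_abs_le (d : ℕ) :
    ∑ j ∈ Finset.Icc (-(d : ℤ)) d, (if j = 0 then 1 else |(j : ℝ)|⁻¹) ≤ 3 + 2 * Real.log d := by
  have hsum : ∀ n : ℕ, ∑ j ∈ Finset.Icc (-(n : ℤ)) n, (if j = 0 then 1 else |(j : ℝ)|⁻¹)
      = 1 + 2 * ((harmonic n : ℚ) : ℝ) := by
    intro n
    induction n with
    | zero => simp
    | succ n ih =>
      have h : Finset.Icc (-((n + 1 : ℕ) : ℤ)) (n + 1 : ℕ)
          = insert (-((n : ℤ) + 1)) (insert ((n : ℤ) + 1) (Finset.Icc (-(n : ℤ)) n)) := by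
        ext j
        simp only [Finset.mem_Icc, Finset.mem_insert]
        push_cast
        omega
      rw [h, Finset.sum_insert, Finset.sum_insert, ih, harmonic_succ, if_neg (by omega),
        if_neg (by omega)]
      · push_cast
        rw [abs_neg, abs_of_nonneg (by positivity)]
        ring
      · simp
      · simp only [Finset.mem_insert, Finset.mem_Icc]; omega
  rw [hsum]
  linarith [harmonic_le_one_add_log d]

theorem totalWeight_le (d : ℕ) (a : ℝ) (hA : ∫ y in (-Real.pi)..Real.pi, |mollifier d a y| ≤ 2) :
    totalWeight d (coeff d a) ≤ 3 + 2 * Real.log d := by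
  have hpi := Real.pi_gt_three
  refine le_trans (Finset.sum_le_sum fun j hj => ?_) (sum_inv_abs_le d)
  have h := norm_coeff_le d a hA hj
  split_ifs with h0
  · subst h0
    refine h.trans ?_
    calc 2 / (2 * Real.pi) * ‖heavisideIntegral 0‖ ≤ 2 / (2 * Real.pi) * Real.pi := by
          gcongr; exact norm_heavisideIntegral_zero_le
      _ = 1 := by field_simp
  · have hj0 : 0 < |(j : ℝ)| := abs_pos.2 (by exact_mod_cast h0)
    refine h.trans ?_
    calc 2 / (2 * Real.pi) * ‖heavisideIntegral j‖ ≤ 2 / (2 * 3) * (2 / |(j : ℝ)|) := by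
          gcongr; exact norm_heavisideIntegral_le h0
      _ ≤ |(j : ℝ)|⁻¹ := by
          rw [inv_eq_one_div, div_mul_div_comm, div_le_div_iff₀ (by positivity) hj0]; linarith

/-! ### The Hadamard test -/

section HadamardTest

variable {ι : Type*} [Fintype ι] [DecidableEq ι]

theorem trace_ketBra_mul (b : Fin 2) (X Y : Matrix (Fin 2) (Fin 2) ℂ) :
    (ketBra b * (X * ketBra 0 * Yᴴ)).trace = X b 0 * star (Y b 0) := by
  unfold ketBra
  rw [Matrix.trace_single_mul, Matrix.mul_apply]
  simp

theorem circuit_eq (W : Matrix (Fin 2) (Fin 2) ℂ) (U : Matrix ι ι ℂ) :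
    circuit W U = (hadamard * W * ketBra 0 * hadamard) ⊗ₖ (1 : Matrix ι ι ℂ)
      + (hadamard * W * ketBra 1 * hadamard) ⊗ₖ U := by
  unfold circuit controlled
  rw [← Matrix.mul_kronecker_mul, Matrix.mul_add, ← Matrix.mul_kronecker_mul,
    ← Matrix.mul_kronecker_mul, Matrix.add_mul, ← Matrix.mul_kronecker_mul,
    ← Matrix.mul_kronecker_mul]
  simp

/-- With the ancilla starting in `|0⟩` and found in `b`, the system undergoes `α • 1 + β • U`. The
four terms come from expanding `(α • 1 + β • U) ρ (α • 1 + β • U)ᴴ`. -/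
theorem outcomeProb_eq_of_entries (W : Matrix (Fin 2) (Fin 2) ℂ) (U ρ : Matrix ι ι ℂ) (b : Fin 2)
    {α β : ℂ} (hα : (hadamard * W * ketBra 0 * hadamard) b 0 = α)
    (hβ : (hadamard * W * ketBra 1 * hadamard) b 0 = β) :
    outcomeProb W U ρ b = (α * star α * ρ.trace + α * star β * (ρ * Uᴴ).trace
      + β * star α * (U * ρ).trace + β * star β * (U * ρ * Uᴴ).trace).re := by
  unfold outcomeProb
  rw [circuit_eq]
  simp only [Matrix.conjTranspose_add, Matrix.conjTranspose_kronecker, Matrix.mul_add,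
    Matrix.add_mul, ← Matrix.mul_kronecker_mul, Matrix.trace_add, Matrix.trace_kronecker,
    trace_ketBra_mul, hα, hβ, Matrix.conjTranspose_one, Matrix.one_mul, Matrix.mul_one]
  ring_nf

theorem mul_ketBra_mul_apply (X Y : Matrix (Fin 2) (Fin 2) ℂ) (b k c : Fin 2) :
    (X * ketBra k * Y) b c = X b k * Y k c := by
  unfold ketBra
  rw [Matrix.mul_assoc, Matrix.mul_apply, Finset.sum_eq_single_of_mem k (Finset.mem_univ k)]
  · simp
  · intro l _ hl
    rw [Matrix.single_mul_apply_of_ne _ _ _ _ _ hl, mul_zero]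

theorem inv_sqrt_two_mul_inv_sqrt_two : ((Real.sqrt 2 : ℂ))⁻¹ * ((Real.sqrt 2 : ℂ))⁻¹ = 2⁻¹ := by
  rw [← mul_inv, ← Complex.ofReal_mul, Real.mul_self_sqrt (by norm_num)]; norm_num

theorem hadamard_one_entries (b k : Fin 2) :
    (hadamard * (1 : Matrix (Fin 2) (Fin 2) ℂ) * ketBra k * hadamard) b 0
      = if b = 1 ∧ k = 1 then -(1 / 2) else 1 / 2 := by
  rw [mul_ketBra_mul_apply, Matrix.mul_one]
  fin_cases b <;> fin_cases k <;> simp [hadamard, inv_sqrt_two_mul_inv_sqrt_two]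

theorem hadamard_phaseGate_entries (b k : Fin 2) :
    (hadamard * phaseGateᴴ * ketBra k * hadamard) b 0
      = if k = 0 then 1 / 2 else if b = 0 then -(Complex.I / 2) else Complex.I / 2 := by
  have hs : ((Real.sqrt 2 : ℂ))⁻¹ * Complex.I * ((Real.sqrt 2 : ℂ))⁻¹ = Complex.I / 2 := by
    rw [mul_right_comm, inv_sqrt_two_mul_inv_sqrt_two]; ring
  rw [mul_ketBra_mul_apply, Matrix.mul_apply, Fin.sum_univ_two]
  simp only [Matrix.conjTranspose_apply]
  fin_cases b <;> fin_cases k <;>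
    simp [hadamard, phaseGate, inv_sqrt_two_mul_inv_sqrt_two, hs]

omit [DecidableEq ι] in
theorem trace_mul_conjTranspose_eq {U ρ : Matrix ι ι ℂ} (hρ : ρ.IsHermitian) :
    (ρ * Uᴴ).trace = star (U * ρ).trace := by
  rw [← Matrix.trace_conjTranspose, Matrix.conjTranspose_mul, hρ.eq]

theorem trace_conj_eq {U ρ : Matrix ι ι ℂ} (hU : Uᴴ * U = 1) : (U * ρ * Uᴴ).trace = ρ.trace := by
  rw [Matrix.trace_mul_comm, ← Matrix.mul_assoc, hU, Matrix.one_mul]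

theorem outcomeProb_one {U ρ : Matrix ι ι ℂ} (hU : Uᴴ * U = 1) (hρ : IsDensityMatrix ρ)
    (b : Fin 2) :
    outcomeProb 1 U ρ b = (1 + (if b = 0 then 1 else -1) * (U * ρ).trace.re) / 2 := by
  rw [outcomeProb_eq_of_entries 1 U ρ b (hadamard_one_entries b 0) (hadamard_one_entries b 1),
    trace_conj_eq hU, trace_mul_conjTranspose_eq hρ.1.isHermitian, hρ.2]
  fin_cases b <;> simp <;> ring

/-- The gate `S†` multiplies the interference term by `-i`, so its real part becomes the imaginary
part of the trace. -/
theorem outcomeProb_phaseGate {U ρ : Matrix ι ι ℂ} (hU : Uᴴ * U = 1) (hρ : IsDensityMatrix ρ)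
    (b : Fin 2) :
    outcomeProb phaseGateᴴ U ρ b = (1 + (if b = 0 then 1 else -1) * (U * ρ).trace.im) / 2 := by
  rw [outcomeProb_eq_of_entries phaseGateᴴ U ρ b (hadamard_phaseGate_entries b 0)
      (hadamard_phaseGate_entries b 1),
    trace_conj_eq hU, trace_mul_conjTranspose_eq hρ.1.isHermitian, hρ.2]
  fin_cases b <;> simp <;> ring

end HadamardTest

/-! ### The spectral measure -/

section Spectral

variable {ι : Type*} [Fintype ι] [DecidableEq ι] {H ρ : Matrix ι ι ℂ} (hH : H.IsHermitian)

/-- The unitary matrix of eigenvectors of `H`. -/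
noncomputable def eigenMatrix : Matrix ι ι ℂ := hH.eigenvectorUnitary

theorem star_eigenMatrix_mul : (eigenMatrix hH)ᴴ * eigenMatrix hH = 1 :=
  Unitary.coe_star_mul_self hH.eigenvectorUnitary

theorem eigenMatrix_mul_star : eigenMatrix hH * (eigenMatrix hH)ᴴ = 1 :=
  Unitary.coe_mul_star_self hH.eigenvectorUnitary

/-- The weight `⟨v|ρ|v⟩` of the `i`-th eigenvector. -/
noncomputable def weight (ρ : Matrix ι ι ℂ) (i : ι) : ℝ :=
  (((eigenMatrix hH)ᴴ * ρ * eigenMatrix hH) i i).re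

theorem weight_nonneg (hρ : IsDensityMatrix ρ) (i : ι) : 0 ≤ weight hH ρ i :=
  (Complex.le_def.1 (hρ.1.conjTranspose_mul_mul_same (eigenMatrix hH)).diag_nonneg).1

theorem ofReal_weight (hρ : IsDensityMatrix ρ) (i : ι) :
    (weight hH ρ i : ℂ) = ((eigenMatrix hH)ᴴ * ρ * eigenMatrix hH) i i :=
  Complex.ext rfl
    (Complex.le_def.1 (hρ.1.conjTranspose_mul_mul_same (eigenMatrix hH)).diag_nonneg).2

theorem sum_weight (hρ : IsDensityMatrix ρ) : ∑ i, weight hH ρ i = 1 := by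
  have h : ((eigenMatrix hH)ᴴ * ρ * eigenMatrix hH).trace = 1 := by
    rw [Matrix.trace_mul_comm, ← Matrix.mul_assoc, eigenMatrix_mul_star, Matrix.one_mul, hρ.2]
  have := congrArg Complex.re h
  rw [Matrix.trace, Complex.re_sum] at this
  simpa [weight] using this

theorem trace_mul_vecMulVec (i : ι) :
    (ρ * Matrix.vecMulVec (hH.eigenvectorBasis i : ι → ℂ)
      (star (hH.eigenvectorBasis i : ι → ℂ))).trace
      = ((eigenMatrix hH)ᴴ * ρ * eigenMatrix hH) i i := by
  rw [Matrix.mul_vecMulVec, Matrix.trace_vecMulVec, dotProduct_comm, Matrix.mul_assoc,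
    Matrix.mul_apply]
  rfl

theorem overlap_eq (lam : ℝ) :
    overlap hH ρ lam = ∑ i with hH.eigenvalues i = lam, weight hH ρ i := by
  unfold overlap eigenProj
  rw [Finset.mul_sum, Matrix.trace_sum, Complex.re_sum]
  exact Finset.sum_congr rfl fun i _ => congrArg Complex.re (trace_mul_vecMulVec hH i)

/-- Grouping an eigenbasis by eigenvalue shows that degeneracies play no role: all later estimates
are sums over basis vectors with nonnegative weights of total 1. -/
theorem cdf_eq (τ x : ℝ) :
    cdf hH ρ τ x = ∑ i, weight hH ρ i * heaviside (x - τ * hH.eigenvalues i) := by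
  unfold cdf distinctEigenvalues
  rw [← Finset.sum_fiberwise_of_maps_to (s := Finset.univ) (g := hH.eigenvalues)
    (t := Finset.univ.image hH.eigenvalues) fun i hi => Finset.mem_image_of_mem _ hi]
  refine Finset.sum_congr rfl fun lam _ => ?_
  rw [overlap_eq, Finset.sum_mul]
  refine Finset.sum_congr rfl fun i hi => ?_
  rw [(Finset.mem_filter.1 hi).2]

theorem evolution_eq (τ : ℝ) (j : ℤ) : evolution H τ j = eigenMatrix hH
    * Matrix.diagonal (fun i => character (-j) (τ * hH.eigenvalues i)) * (eigenMatrix hH)ᴴ := by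
  have hinv : (eigenMatrix hH)⁻¹ = (eigenMatrix hH)ᴴ :=
    Matrix.inv_eq_left_inv (star_eigenMatrix_mul hH)
  have hunit : IsUnit (eigenMatrix hH) :=
    ⟨⟨eigenMatrix hH, (eigenMatrix hH)ᴴ, eigenMatrix_mul_star hH, star_eigenMatrix_mul hH⟩, rfl⟩
  have hspec : H = eigenMatrix hH * Matrix.diagonal (RCLike.ofReal ∘ hH.eigenvalues)
      * (eigenMatrix hH)ᴴ := by
    have := hH.spectral_theorem
    rwa [Unitary.conjStarAlgAut_apply] at this
  have harg : (-(Complex.I * j * τ)) • H = eigenMatrix hH *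
      Matrix.diagonal (fun i => -(Complex.I * j * τ) * (hH.eigenvalues i : ℂ))
      * (eigenMatrix hH)⁻¹ := by
    conv_lhs => rw [hspec]
    rw [hinv, ← Matrix.smul_mul, ← Matrix.mul_smul, ← Matrix.diagonal_smul]
    rfl
  unfold evolution
  rw [harg, Matrix.exp_conj _ _ hunit, Matrix.exp_diagonal, hinv]
  congr 3
  funext i
  rw [Pi.coe_exp, ← Complex.exp_eq_exp_ℂ, character]
  push_cast
  ring_nf

include hH in
theorem evolution_isometry (τ : ℝ) (j : ℤ) : (evolution H τ j)ᴴ * evolution H τ j = 1 := by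
  rw [evolution_eq hH]
  set V := eigenMatrix hH
  set E := Matrix.diagonal (fun i => character (-j) (τ * hH.eigenvalues i)) with hE
  have hEE : Eᴴ * E = 1 := by
    rw [hE, Matrix.diagonal_conjTranspose, Matrix.diagonal_mul_diagonal, ← Matrix.diagonal_one]
    congr 1
    funext i
    simp only [Pi.star_apply]
    rw [RCLike.star_def, Complex.conj_mul', norm_character]; norm_num
  calc (V * E * Vᴴ)ᴴ * (V * E * Vᴴ) = V * (Eᴴ * ((Vᴴ * V) * E)) * Vᴴ := by
        simp only [Matrix.conjTranspose_mul, Matrix.conjTranspose_conjTranspose, Matrix.mul_assoc]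
    _ = 1 := by
        rw [star_eigenMatrix_mul, Matrix.one_mul, hEE, Matrix.mul_one, eigenMatrix_mul_star]

theorem trace_evolution_mul (hρ : IsDensityMatrix ρ) (τ : ℝ) (j : ℤ) :
    (evolution H τ j * ρ).trace
      = ∑ i, (weight hH ρ i : ℂ) * character j (-(τ * hH.eigenvalues i)) := by
  rw [evolution_eq hH, Matrix.mul_assoc, Matrix.trace_mul_comm, ← Matrix.mul_assoc, Matrix.trace]
  refine Finset.sum_congr rfl fun i _ => ?_
  rw [Matrix.diag_apply, Matrix.mul_diagonal, ofReal_weight hH hρ, character, character]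
  push_cast
  ring_nf

theorem abs_eigenvalues_le (i : ι) :
    |hH.eigenvalues i| ≤ ‖Matrix.toEuclideanCLM (n := ι) (𝕜 := ℂ) H‖ := by
  have h := (Matrix.toEuclideanCLM (n := ι) (𝕜 := ℂ) H).le_opNorm (hH.eigenvectorBasis i)
  have h2 : Matrix.toEuclideanCLM (n := ι) (𝕜 := ℂ) H (hH.eigenvectorBasis i)
      = (hH.eigenvalues i) • hH.eigenvectorBasis i := by
    apply (WithLp.ofLp_injective 2)
    rw [Matrix.ofLp_toEuclideanCLM, hH.mulVec_eigenvectorBasis]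
    rfl
  rw [h2, norm_smul, hH.eigenvectorBasis.orthonormal.1 i, mul_one, mul_one] at h
  exact h

theorem abs_mul_eigenvalues_lt {τ : ℝ} (hτ : 0 < τ)
    (h : τ * ‖Matrix.toEuclideanCLM (n := ι) (𝕜 := ℂ) H‖ < Real.pi / 3) (i : ι) :
    |τ * hH.eigenvalues i| < Real.pi / 3 := by
  rw [abs_mul, abs_of_pos hτ]
  exact lt_of_le_of_lt (mul_le_mul_of_nonneg_left (abs_eigenvalues_le hH i) hτ.le) h

end Spectral

/-! ### The smoothed cumulative distribution function -/

section SmoothedCDF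

variable {ι : Type*} [Fintype ι] [DecidableEq ι] {H ρ : Matrix ι ι ℂ} (hH : H.IsHermitian)

/-- The convolution of the approximate Heaviside function with the spectral measure. -/
noncomputable def smoothCdf (d : ℕ) (a : ℝ) (ρ : Matrix ι ι ℂ) (τ x : ℝ) : ℝ :=
  ∑ i, weight hH ρ i * approxHeaviside d a (x - τ * hH.eigenvalues i)

/-- The periodic step is not monotone, but for these points and eigenvalues its arguments stay
strictly between `-π` and `π`, where it is. -/
theorem cdf_mono (hρ : IsDensityMatrix ρ) {τ : ℝ}
    (hτ : ∀ i, |τ * hH.eigenvalues i| < Real.pi / 3) :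
    MonotoneOn (cdf hH ρ τ) (Set.Icc (-(2 * Real.pi / 3)) (2 * Real.pi / 3)) := by
  intro x hx y hy hxy
  rw [cdf_eq, cdf_eq]
  refine Finset.sum_le_sum fun i _ => mul_le_mul_of_nonneg_left ?_ (weight_nonneg hH hρ i)
  have h := abs_lt.1 (hτ i)
  rcases lt_or_ge (x - τ * hH.eigenvalues i) 0 with h0 | h0
  · rw [heaviside_of_neg (by linarith [hx.1]) h0]
    exact heaviside_nonneg _
  · rw [heaviside_of_nonneg (x := y - τ * hH.eigenvalues i) (by linarith) (by linarith [hy.2])]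
    exact heaviside_le_one _

theorem cdf_right (hρ : IsDensityMatrix ρ) {τ : ℝ}
    (hτ : ∀ i, |τ * hH.eigenvalues i| < Real.pi / 3) : cdf hH ρ τ (Real.pi / 3) = 1 := by
  rw [cdf_eq, ← sum_weight hH hρ]
  refine Finset.sum_congr rfl fun i _ => ?_
  have h := abs_lt.1 (hτ i)
  rw [heaviside_of_nonneg (by linarith) (by linarith [Real.pi_pos]), mul_one]

theorem cdf_left {τ : ℝ}
    (hτ : ∀ i, |τ * hH.eigenvalues i| < Real.pi / 3) : cdf hH ρ τ (-(Real.pi / 3)) = 0 := by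
  rw [cdf_eq]
  refine Finset.sum_eq_zero fun i _ => ?_
  have h := abs_lt.1 (hτ i)
  rw [heaviside_of_neg (by linarith [Real.pi_pos]) (by linarith), mul_zero]

variable {d : ℕ} {a ε : ℝ} (h0 : 0 < a) (h1 : a ≤ Real.pi / 9)
  (hN : 0 < ∫ y in (-Real.pi)..Real.pi, bump d a y)
  (hε : 2 * Real.pi / (∫ y in (-Real.pi)..Real.pi, bump d a y) ≤ ε)

include h0 h1 hN hε

/-- The weights sum to 1, so the pointwise error passes unchanged to the average over the spectrum.
-/
theorem smoothCdf_le (hρ : IsDensityMatrix ρ) {τ x : ℝ}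
    (hτ : ∀ i, |τ * hH.eigenvalues i| < Real.pi / 3) (hx : |x| ≤ Real.pi / 3) :
    smoothCdf hH d a ρ τ x ≤ cdf hH ρ τ (x + a) + ε := by
  rw [cdf_eq]
  have : ε = ∑ i, weight hH ρ i * ε := by rw [← Finset.sum_mul, sum_weight hH hρ, one_mul]
  rw [this, ← Finset.sum_add_distrib, smoothCdf]
  refine Finset.sum_le_sum fun i _ => ?_
  rw [← mul_add, show x + a - τ * hH.eigenvalues i = x - τ * hH.eigenvalues i + a by ring]
  refine mul_le_mul_of_nonneg_left ?_ (weight_nonneg hH hρ i)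
  refine approxHeaviside_le_heaviside_add h0 h1 hN hε ?_
  have h := abs_lt.1 (hτ i)
  have h' := abs_le.1 hx
  rw [abs_lt]; constructor <;> linarith

theorem le_smoothCdf (hρ : IsDensityMatrix ρ) {τ x : ℝ}
    (hτ : ∀ i, |τ * hH.eigenvalues i| < Real.pi / 3) (hx : |x| ≤ Real.pi / 3) :
    cdf hH ρ τ (x - a) - ε ≤ smoothCdf hH d a ρ τ x := by
  rw [cdf_eq]
  have : ε = ∑ i, weight hH ρ i * ε := by rw [← Finset.sum_mul, sum_weight hH hρ, one_mul]
  rw [this, ← Finset.sum_sub_distrib, smoothCdf]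
  refine Finset.sum_le_sum fun i _ => ?_
  rw [← mul_sub, show x - a - τ * hH.eigenvalues i = x - τ * hH.eigenvalues i - a by ring]
  refine mul_le_mul_of_nonneg_left ?_ (weight_nonneg hH hρ i)
  refine heaviside_sub_le_approxHeaviside h0 h1 hN hε ?_
  have h := abs_lt.1 (hτ i)
  have h' := abs_le.1 hx
  rw [abs_lt]; constructor <;> linarith

end SmoothedCDF

/-! ### Probability -/

section Probability

variable {Ω : Type*} [MeasurableSpace Ω] {P : Measure Ω}

theorem integrable_and_integral_of_ae_mem_finset [IsProbabilityMeasure P] {α : Type*}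
    [MeasurableSpace α] [MeasurableSingletonClass α] {T : Ω → α} (hT : Measurable T)
    {s : Finset α} (hs : ∀ᵐ ω ∂P, T ω ∈ s) (f : α → ℝ) :
    Integrable (fun ω => f (T ω)) P ∧
      ∫ ω, f (T ω) ∂P = ∑ a ∈ s, f a * P.real {ω | T ω = a} := by
  classical
  have hmeas : ∀ a, MeasurableSet {ω | T ω = a} := fun a => hT (measurableSet_singleton a)
  have hae : (fun ω => f (T ω)) =ᵐ[P]
      fun ω => ∑ a ∈ s, ({ω | T ω = a} : Set Ω).indicator (fun _ => f a) ω := by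
    filter_upwards [hs] with ω hω
    rw [Finset.sum_eq_single_of_mem (T ω) hω]
    · simp
    · intro a _ ha
      rw [Set.indicator_of_notMem]
      simpa using ha.symm
  have hi : ∀ a ∈ s, Integrable (({ω | T ω = a} : Set Ω).indicator (fun _ => f a)) P :=
    fun a _ => (integrable_const _).indicator (hmeas a)
  refine ⟨(integrable_finsetSum _ hi).congr ?_, ?_⟩
  · filter_upwards [hae] with ω h
    exact h.symm
  · rw [integral_congr_ae hae, integral_finsetSum _ hi]
    refine Finset.sum_congr rfl fun a _ => ?_
    rw [integral_indicator_const _ (hmeas a), smul_eq_mul, mul_comm]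

/-- Independence means that the joint law is a product measure, and currying the index set turns a
product over pairs into a product of products. This makes whole batches independent of one another.
-/
theorem iIndepFun_rows {ι κ 𝓧 : Type*} [MeasurableSpace 𝓧] {X : ι × κ → Ω → 𝓧}
    (hm : ∀ p, Measurable (X p)) (h : iIndepFun X P) :
    iIndepFun (fun (i : ι) ω (k : κ) => X (i, k) ω) P := by
  have := h.isProbabilityMeasure
  have hP : ∀ i k, IsProbabilityMeasure (P.map (X (i, k))) :=
    fun i k => Measure.isProbabilityMeasure_map (hm _).aemeasurable
  have hrow : ∀ i, P.map (fun ω (k : κ) => X (i, k) ω)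
      = Measure.infinitePi fun k => P.map (X (i, k)) := fun i =>
    (h.precomp (g := fun k : κ => (i, k)) fun a b hab => (Prod.mk.inj hab).2).map_fun_eq_infinitePi_map
      fun k => hm _
  rw [iIndepFun_iff_map_fun_eq_infinitePi_map fun i => by fun_prop]
  simp_rw [hrow]
  rw [← Measure.infinitePi_map_curry (fun i k => P.map (X (i, k))),
    ← h.map_fun_eq_infinitePi_map hm, Measure.map_map (by fun_prop) (by fun_prop)]
  rfl

/-- Chebyshev's inequality for the mean of independent bounded variables. -/
theorem measureReal_abs_mean_sub_ge_le [IsProbabilityMeasure P] {n : ℕ} (hn : 0 < n)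
    {X : Fin n → Ω → ℝ} (hm : ∀ k, Measurable (X k)) (hX : iIndepFun X P) {B μ c : ℝ}
    (hB : ∀ k ω, |X k ω| ≤ B) (hμ : ∀ k, ∫ ω, X k ω ∂P = μ) (hc : 0 < c) :
    P.real {ω | c ≤ |(∑ k, X k ω) / n - μ|} ≤ B ^ 2 / (n * c ^ 2) := by
  have hn' : (0 : ℝ) < n := by exact_mod_cast hn
  have hLp : ∀ k, MemLp (X k) 2 P := fun k =>
    MemLp.of_bound (hm k).aestronglyMeasurable B (ae_of_all _ (hB k))
  have hLpS : MemLp (∑ k, X k) 2 P := memLp_finsetSum' _ fun k _ => hLp k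
  have hvar : variance (∑ k, X k) P ≤ n * B ^ 2 := by
    rw [IndepFun.variance_sum (fun k _ => hLp k) fun i _ j _ hij => hX.indepFun hij]
    calc ∑ k, variance (X k) P ≤ ∑ _k : Fin n, B ^ 2 := by
          refine Finset.sum_le_sum fun k _ => ?_
          have := variance_le_sq_of_bounded (μ := P) (a := -B) (b := B)
            (ae_of_all _ fun ω => abs_le.1 (hB k ω)) (hm k).aemeasurable
          refine this.trans (le_of_eq ?_)
          ring
      _ = n * B ^ 2 := by simp
  have hmean : ∫ ω, (∑ k, X k) ω ∂P = n * μ := by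
    simp_rw [Finset.sum_apply]
    rw [integral_finsetSum _ fun k _ => (hLp k).integrable (by norm_num)]
    simp [hμ]
  have hset : {ω | c ≤ |(∑ k, X k ω) / n - μ|}
      = {ω | n * c ≤ |(∑ k, X k) ω - ∫ ω, (∑ k, X k) ω ∂P|} := by
    ext ω
    simp only [Set.mem_ofPred_eq]
    rw [hmean, Finset.sum_apply]
    have : |∑ k, X k ω - n * μ| = n * |(∑ k, X k ω) / n - μ| := by
      rw [← abs_of_pos hn', ← abs_mul, abs_of_pos hn']
      congr 1
      field_simp
    rw [this]
    exact (mul_le_mul_iff_of_pos_left hn').symm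
  rw [hset, measureReal_def]
  have h := meas_ge_le_variance_div_sq hLpS (c := n * c) (by positivity)
  refine (ENNReal.toReal_mono ENNReal.ofReal_ne_top h).trans ?_
  rw [ENNReal.toReal_ofReal (div_nonneg (variance_nonneg _ _) (by positivity))]
  calc variance (∑ k, X k) P / (n * c) ^ 2 ≤ n * B ^ 2 / (n * c) ^ 2 := by gcongr
    _ = B ^ 2 / (n * c ^ 2) := by field_simp

/-- A majority of independent events of probability at most `1/4` is exponentially unlikely. -/
theorem measureReal_majority_le [IsProbabilityMeasure P] {n : ℕ} {α : Type*} [MeasurableSpace α]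
    {R : Fin n → Ω → α} (hm : ∀ r, Measurable (R r)) (hR : iIndepFun R P) {B : Set α}
    [DecidablePred (· ∈ B)] (hB : MeasurableSet B) (hp : ∀ r, P.real {ω | R r ω ∈ B} ≤ 1 / 4) :
    P.real {ω | (n : ℝ) / 2 ≤ (Finset.univ.filter fun r => R r ω ∈ B).card}
      ≤ Real.exp (-(n / 8)) := by
  have hmB : Measurable (B.indicator fun _ => (1 : ℝ)) := measurable_const.indicator hB
  set Y : Fin n → Ω → ℝ := fun r ω => B.indicator (fun _ => (1 : ℝ)) (R r ω) with hY
  have hYm : ∀ r, Measurable (Y r) := fun r => hmB.comp (hm r)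
  have hmean : ∀ r, ∫ ω, Y r ω ∂P ≤ 1 / 4 := by
    intro r
    have : Y r = ({ω | R r ω ∈ B}).indicator fun _ => (1 : ℝ) := rfl
    have hs : MeasurableSet {ω | R r ω ∈ B} := hm r hB
    rw [this, integral_indicator_const _ hs, smul_eq_mul, mul_one]
    exact hp r
  have hsub : ∀ r, HasSubgaussianMGF (fun ω => Y r ω - ∫ ω, Y r ω ∂P) ((‖(1 : ℝ) - 0‖₊ / 2) ^ 2) P :=
    fun r => hasSubgaussianMGF_of_mem_Icc (hYm r).aemeasurable (ae_of_all _ fun ω => by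
      by_cases h : R r ω ∈ B <;> simp [hY, h])
  have hind : iIndepFun (fun r ω => Y r ω - ∫ ω, Y r ω ∂P) P :=
    hR.comp (fun r a => B.indicator (fun _ => (1 : ℝ)) a - ∫ ω, Y r ω ∂P)
      fun r => hmB.sub measurable_const
  -- The expected count is at most `n / 4`, so a count of `n / 2` deviates by at least `n / 4`.
  -- Indicators have sub-Gaussian parameter `1 / 4`, which gives the exponent `(n / 4)² / (n / 2) =
  -- n / 8`.
  have h := HasSubgaussianMGF.measure_sum_ge_le_of_iIndepFun hind (s := Finset.univ)
    (fun r _ => hsub r) (ε := n / 4) (by positivity)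
  refine le_trans (measureReal_mono ?_) (h.trans (le_of_eq ?_))
  · intro ω hω
    simp only [Set.mem_ofPred_eq] at hω ⊢
    rw [Finset.sum_sub_distrib]
    have h1 : ∑ r, Y r ω = (Finset.univ.filter fun r => R r ω ∈ B).card := by
      rw [Finset.card_filter]
      push_cast
      refine Finset.sum_congr rfl fun r _ => ?_
      simp [hY, Set.indicator_apply]
    have h2 : ∑ r : Fin n, ∫ ω, Y r ω ∂P ≤ n / 4 := by
      calc ∑ r : Fin n, ∫ ω, Y r ω ∂P ≤ ∑ _r : Fin n, (1 / 4 : ℝ) :=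
            Finset.sum_le_sum fun r _ => hmean r
        _ = n / 4 := by simp; ring
    rw [h1]
    linarith
  · congr 1
    rcases Nat.eq_zero_or_pos n with h0 | h0
    · subst h0; simp
    have hn : (n : ℝ) ≠ 0 := by positivity
    simp
    field_simp
    norm_num

end Probability

/-! ### The samples -/

/-- The real value `±1` of a measurement outcome. -/
noncomputable def outcomeSign (b : Fin 2) : ℝ := if b = 0 then 1 else -1

theorem abs_outcomeSign (b : Fin 2) : |outcomeSign b| = 1 := by
  unfold outcomeSign; split_ifs <;> simp

theorem signValue_eq (b : Fin 2) : signValue b = (outcomeSign b : ℂ) := by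
  unfold signValue outcomeSign; split_ifs <;> simp

/-- One term depends on the `X` outcome alone and the other on the `Y` outcome alone. This is why
the correlation of the two outcomes within a sample does not affect the mean. -/
theorem G_re (d : ℕ) (F : ℤ → ℂ) (x : ℝ) (s : Sample) :
    (G d F x s).re = totalWeight d F * Real.cos ((F s.1).arg + s.1 * x) * outcomeSign s.2.1
      - totalWeight d F * Real.sin ((F s.1).arg + s.1 * x) * outcomeSign s.2.2 := by
  unfold G zValue
  rw [mul_comm Complex.I ((_ : ℝ) : ℂ), Complex.exp_mul_I, signValue_eq, signValue_eq,
    ← Complex.ofReal_cos, ← Complex.ofReal_sin]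
  simp only [Complex.mul_re, Complex.add_re, Complex.add_im, Complex.ofReal_re, Complex.ofReal_im,
    Complex.I_re, Complex.I_im, Complex.mul_im]
  ring

theorem totalWeight_nonneg (d : ℕ) (F : ℤ → ℂ) : 0 ≤ totalWeight d F :=
  Finset.sum_nonneg fun _ _ => norm_nonneg _

theorem abs_G_re_le (d : ℕ) (F : ℤ → ℂ) (x : ℝ) (s : Sample) :
    |(G d F x s).re| ≤ 2 * totalWeight d F := by
  have hw := totalWeight_nonneg d F
  rw [G_re]
  refine (abs_sub _ _).trans ?_
  rw [abs_mul, abs_mul, abs_mul, abs_mul, abs_outcomeSign, abs_outcomeSign, abs_of_nonneg hw]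
  nlinarith [Real.abs_cos_le_one ((F s.1).arg + s.1 * x),
    Real.abs_sin_le_one ((F s.1).arg + s.1 * x)]

/-- If the total weight vanishes, the division gives the default value 0, but then every coefficient
in the range vanishes as well. -/
theorem totalWeight_mul_probJ {d : ℕ} {F : ℤ → ℂ} {j : ℤ} (hj : j ∈ Finset.Icc (-(d : ℤ)) d) :
    totalWeight d F * probJ d F j = ‖F j‖ := by
  rw [probJ, if_pos hj]
  by_cases h : totalWeight d F = 0
  · rw [h, zero_mul]
    exact ((Finset.sum_eq_zero_iff_of_nonneg fun _ _ => norm_nonneg _).1 h j hj).symm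
  · rw [mul_div_cancel₀ _ h]

theorem probJ_nonneg (d : ℕ) (F : ℤ → ℂ) (j : ℤ) : 0 ≤ probJ d F j := by
  unfold probJ
  split_ifs
  · exact div_nonneg (norm_nonneg _) (totalWeight_nonneg d F)
  · exact le_rfl

theorem meanAbsJ_le (d : ℕ) (F : ℤ → ℂ) : meanAbsJ d F ≤ d := by
  have h1 : ∑ j ∈ Finset.Icc (-(d : ℤ)) d, probJ d F j ≤ 1 := by
    have : ∑ j ∈ Finset.Icc (-(d : ℤ)) d, probJ d F j = totalWeight d F / totalWeight d F := by
      conv_rhs => rw [totalWeight, Finset.sum_div]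
      refine Finset.sum_congr rfl fun j hj => ?_
      rw [probJ, if_pos hj]; rfl
    rw [this]
    exact div_self_le_one _
  calc meanAbsJ d F ≤ ∑ j ∈ Finset.Icc (-(d : ℤ)) d, probJ d F j * d := by
        refine Finset.sum_le_sum fun j hj => mul_le_mul_of_nonneg_left ?_ (probJ_nonneg d F j)
        have := Finset.mem_Icc.1 hj
        rw [abs_le]
        exact ⟨by exact_mod_cast this.1, by exact_mod_cast this.2⟩
    _ ≤ 1 * d := by rw [← Finset.sum_mul]; gcongr
    _ = d := one_mul _

section Samples

variable {ι : Type*} [Fintype ι] [DecidableEq ι] {d : ℕ} {F : ℤ → ℂ} {H ρ : Matrix ι ι ℂ} {τ : ℝ}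
  {M : ℕ} {Ω : Type*} [MeasurableSpace Ω] {P : Measure Ω} [IsProbabilityMeasure P]
  {S : Fin M → Ω → Sample}

/-- The two outcome probabilities of the circuit sum to 1, so the law of `J` is a marginal of the
joint law with `X`. -/
theorem IsSampleFamily.measureReal_fst (hS : IsSampleFamily d F H ρ τ P S) (hH : H.IsHermitian)
    (hρ : IsDensityMatrix ρ) (k : Fin M) (j : ℤ) :
    P.real {ω | (S k ω).1 = j} = probJ d F j := by
  have hm := hS.measurable k
  have hset : {ω | (S k ω).1 = j} = {ω | (S k ω).1 = j ∧ (S k ω).2.1 = 0}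
      ∪ {ω | (S k ω).1 = j ∧ (S k ω).2.1 = 1} := by
    ext ω
    simp only [Set.mem_ofPred_eq, Set.mem_union]
    rcases Fin.exists_fin_two.1 ⟨(S k ω).2.1, rfl⟩ with h | h <;> simp [h]
  have hmeas : MeasurableSet {ω | (S k ω).1 = j ∧ (S k ω).2.1 = 1} :=
    ((measurable_fst.comp hm) (measurableSet_singleton j)).inter
      ((measurable_fst.comp (measurable_snd.comp hm)) (measurableSet_singleton 1))
  rw [hset, measureReal_union ?_ hmeas, hS.law_X, hS.law_X,
    outcomeProb_one (evolution_isometry hH τ j) hρ, outcomeProb_one (evolution_isometry hH τ j) hρ]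
  · simp; ring
  · rw [Set.disjoint_left]
    rintro ω ⟨_, h⟩ ⟨_, h'⟩
    rw [h] at h'
    exact absurd h' (by decide)

theorem IsSampleFamily.ae_mem (hS : IsSampleFamily d F H ρ τ P S) (hH : H.IsHermitian)
    (hρ : IsDensityMatrix ρ) (k : Fin M) :
    ∀ᵐ ω ∂P, (S k ω).1 ∈ Finset.Icc (-(d : ℤ)) d := by
  have : ∀ j : ℤ, ∀ᵐ ω ∂P, (S k ω).1 = j → j ∈ Finset.Icc (-(d : ℤ)) d := by
    intro j
    by_cases hj : j ∈ Finset.Icc (-(d : ℤ)) d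
    · exact ae_of_all _ fun _ _ => hj
    · have h := hS.measureReal_fst hH hρ k j
      rw [probJ, if_neg hj, measureReal_eq_zero_iff] at h
      filter_upwards [measure_eq_zero_iff_ae_notMem.1 h] with ω hω hω'
      exact absurd hω' hω
  filter_upwards [ae_all_iff.2 this] with ω hω
  exact hω _ rfl

theorem IsSampleFamily.integral_abs (hS : IsSampleFamily d F H ρ τ P S) (hH : H.IsHermitian)
    (hρ : IsDensityMatrix ρ) (k : Fin M) :
    Integrable (fun ω => τ * |((S k ω).1 : ℝ)|) P ∧
      ∫ ω, τ * |((S k ω).1 : ℝ)| ∂P = τ * meanAbsJ d F := by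
  obtain ⟨h1, h2⟩ := integrable_and_integral_of_ae_mem_finset
    (measurable_fst.comp (hS.measurable k)) (hS.ae_mem hH hρ k) fun j => τ * |(j : ℝ)|
  refine ⟨h1, h2.trans ?_⟩
  rw [meanAbsJ, Finset.mul_sum]
  refine Finset.sum_congr rfl fun j _ => ?_
  have := hS.measureReal_fst hH hρ k j
  simp only [Function.comp_apply]
  rw [this]; ring

theorem IsSampleFamily.integral_mul_outcomeSign_X (hS : IsSampleFamily d F H ρ τ P S)
    (hH : H.IsHermitian) (hρ : IsDensityMatrix ρ) (k : Fin M) (f : ℤ → ℝ) :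
    Integrable (fun ω => f (S k ω).1 * outcomeSign (S k ω).2.1) P ∧
      ∫ ω, f (S k ω).1 * outcomeSign (S k ω).2.1 ∂P
        = ∑ j ∈ Finset.Icc (-(d : ℤ)) d,
          f j * (probJ d F j * (evolution H τ j * ρ).trace.re) := by
  have hm := hS.measurable k
  have hT : Measurable fun ω => ((S k ω).1, (S k ω).2.1) :=
    (measurable_fst.comp hm).prodMk (measurable_fst.comp (measurable_snd.comp hm))
  obtain ⟨h1, h2⟩ := integrable_and_integral_of_ae_mem_finset (P := P) hT
    (s := Finset.Icc (-(d : ℤ)) d ×ˢ (Finset.univ : Finset (Fin 2)))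
    (by filter_upwards [hS.ae_mem hH hρ k] with ω hω
        exact Finset.mem_product.2 ⟨hω, Finset.mem_univ _⟩)
    fun p => f p.1 * outcomeSign p.2
  refine ⟨h1, h2.trans ?_⟩
  rw [Finset.sum_product]
  refine Finset.sum_congr rfl fun j _ => ?_
  simp only [Prod.mk.injEq]
  simp_rw [hS.law_X, outcomeProb_one (evolution_isometry hH τ j) hρ]
  rw [Fin.sum_univ_two]
  simp [outcomeSign]; ring

theorem IsSampleFamily.integral_mul_outcomeSign_Y (hS : IsSampleFamily d F H ρ τ P S)
    (hH : H.IsHermitian) (hρ : IsDensityMatrix ρ) (k : Fin M) (f : ℤ → ℝ) :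
    Integrable (fun ω => f (S k ω).1 * outcomeSign (S k ω).2.2) P ∧
      ∫ ω, f (S k ω).1 * outcomeSign (S k ω).2.2 ∂P
        = ∑ j ∈ Finset.Icc (-(d : ℤ)) d,
          f j * (probJ d F j * (evolution H τ j * ρ).trace.im) := by
  have hm := hS.measurable k
  have hT : Measurable fun ω => ((S k ω).1, (S k ω).2.2) :=
    (measurable_fst.comp hm).prodMk (measurable_snd.comp (measurable_snd.comp hm))
  obtain ⟨h1, h2⟩ := integrable_and_integral_of_ae_mem_finset (P := P) hT
    (s := Finset.Icc (-(d : ℤ)) d ×ˢ (Finset.univ : Finset (Fin 2)))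
    (by filter_upwards [hS.ae_mem hH hρ k] with ω hω
        exact Finset.mem_product.2 ⟨hω, Finset.mem_univ _⟩)
    fun p => f p.1 * outcomeSign p.2
  refine ⟨h1, h2.trans ?_⟩
  rw [Finset.sum_product]
  refine Finset.sum_congr rfl fun j _ => ?_
  simp only [Prod.mk.injEq]
  simp_rw [hS.law_Y, outcomeProb_phaseGate (evolution_isometry hH τ j) hρ]
  rw [Fin.sum_univ_two]
  simp [outcomeSign]; ring

/-- Importance sampling: the factor `𝓕` cancels the normalisation of the law of `J`, and the phase
`e^{iθ_j}` restores the argument of the coefficient. -/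
theorem IsSampleFamily.integral_G_re (hS : IsSampleFamily d F H ρ τ P S) (hH : H.IsHermitian)
    (hρ : IsDensityMatrix ρ) (x : ℝ) (k : Fin M) :
    ∫ ω, (G d F x (S k ω)).re ∂P
      = (∑ j ∈ Finset.Icc (-(d : ℤ)) d,
          F j * character j x * (evolution H τ j * ρ).trace).re := by
  obtain ⟨h1, h2⟩ := hS.integral_mul_outcomeSign_X hH hρ k
    fun j => totalWeight d F * Real.cos ((F j).arg + j * x)
  obtain ⟨h3, h4⟩ := hS.integral_mul_outcomeSign_Y hH hρ k
    fun j => totalWeight d F * Real.sin ((F j).arg + j * x)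
  simp_rw [G_re]
  rw [integral_sub h1 h3, h2, h4, ← Finset.sum_sub_distrib, Complex.re_sum]
  refine Finset.sum_congr rfl fun j hj => ?_
  have hF : F j * character j x = ‖F j‖ * (Real.cos ((F j).arg + j * x)
      + Real.sin ((F j).arg + j * x) * Complex.I) := by
    conv_lhs => rw [← Complex.norm_mul_exp_arg_mul_I (F j)]
    rw [Complex.ofReal_cos, Complex.ofReal_sin, ← Complex.exp_mul_I, character, mul_assoc,
      ← Complex.exp_add]
    push_cast
    ring_nf
  rw [hF, ← totalWeight_mul_probJ hj]
  simp only [Complex.mul_re, Complex.add_re, Complex.add_im, Complex.ofReal_re, Complex.ofReal_im,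
    Complex.I_re, Complex.I_im, Complex.mul_im]
  ring

end Samples

section Batches

variable {ι : Type*} [Fintype ι] [DecidableEq ι] {d : ℕ} {a : ℝ} {H ρ : Matrix ι ι ℂ} {τ : ℝ}
  {Ω : Type*} [MeasurableSpace Ω] {P : Measure Ω} [IsProbabilityMeasure P]

/-- The trace of the evolution is the characteristic function of the spectral measure. Exchanging
the sums over `j` and over the eigenvectors leaves the finite Fourier sum of the smoothed step at
each `x - τ λ_i`. -/
theorem IsSampleFamily.integral_G_re_eq_smoothCdf {M : ℕ} {S : Fin M → Ω → Sample}
    (hS : IsSampleFamily d (coeff d a) H ρ τ P S) (hH : H.IsHermitian)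
    (hρ : IsDensityMatrix ρ) (x : ℝ) (k : Fin M) :
    ∫ ω, (G d (coeff d a) x (S k ω)).re ∂P = smoothCdf hH d a ρ τ x := by
  rw [hS.integral_G_re hH hρ]
  have : (∑ j ∈ Finset.Icc (-(d : ℤ)) d,
      coeff d a j * character j x * (evolution H τ j * ρ).trace)
      = ((smoothCdf hH d a ρ τ x : ℝ) : ℂ) := by
    simp_rw [trace_evolution_mul hH hρ, Finset.mul_sum]
    rw [Finset.sum_comm, smoothCdf]
    push_cast
    refine Finset.sum_congr rfl fun i _ => ?_
    rw [approxHeaviside_eq_sum_coeff, Finset.mul_sum]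
    refine Finset.sum_congr rfl fun j _ => ?_
    rw [sub_eq_add_neg, character_add]
    ring
  rw [this, Complex.ofReal_re]

/-- The mean of `Re G` over a batch. -/
noncomputable def batchAverage (d : ℕ) (F : ℤ → ℂ) (x : ℝ) {n : ℕ} (s : Fin n → Sample) : ℝ :=
  (∑ k, (G d F x (s k)).re) / n

theorem measurable_G_re (d : ℕ) (F : ℤ → ℂ) (x : ℝ) : Measurable fun s => (G d F x s).re :=
  Measurable.of_discrete

theorem measurable_batchAverage (d : ℕ) (F : ℤ → ℂ) (x : ℝ) (n : ℕ) :
    Measurable fun s : Fin n → Sample => batchAverage d F x s := by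
  unfold batchAverage
  exact (Finset.measurable_sum _ fun k _ =>
    (measurable_G_re d F x).comp (measurable_pi_apply k)).div_const _

open Classical in
-- Since `|Re G| ≤ 2𝓕`, Chebyshev's inequality bounds the failure of one batch by `4𝓕² / (Ns c²)`,
-- and `hbig` makes this at most `1 / 4`. The point `x` is fixed and must not depend on the samples.
theorem IsSampleFamily.measureReal_bad_majority_le {Nb Ns : ℕ} {S : Fin (Nb * Ns) → Ω → Sample}
    (hS : IsSampleFamily d (coeff d a) H ρ τ P S) (hH : H.IsHermitian)
    (hρ : IsDensityMatrix ρ) (x : ℝ) {c : ℝ} (hc : 0 < c) (hNs : 0 < Ns)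
    (hbig : 16 * totalWeight d (coeff d a) ^ 2 ≤ Ns * c ^ 2) :
    P.real {ω | (Nb : ℝ) / 2 ≤ (Finset.univ.filter fun r : Fin Nb =>
      c ≤ |batchAverage d (coeff d a) x (fun k : Fin Ns => S (finProdFinEquiv (r, k)) ω)
        - smoothCdf hH d a ρ τ x|).card} ≤ Real.exp (-(Nb / 8)) := by
  have hind : iIndepFun (fun p : Fin Nb × Fin Ns => S (finProdFinEquiv p)) P :=
    hS.indep.precomp finProdFinEquiv.injective
  have hm : ∀ p : Fin Nb × Fin Ns, Measurable (S (finProdFinEquiv p)) := fun p => hS.measurable _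
  refine measureReal_majority_le (P := P)
    (R := fun (r : Fin Nb) ω (k : Fin Ns) => S (finProdFinEquiv (r, k)) ω)
    (B := {s | c ≤ |batchAverage d (coeff d a) x s - smoothCdf hH d a ρ τ x|})
    (fun r => measurable_pi_lambda _ fun k => hm (r, k)) (iIndepFun_rows hm hind) ?_ fun r => ?_
  · exact measurableSet_le measurable_const
      ((measurable_batchAverage d _ x Ns).sub measurable_const).abs
  · have hrow : iIndepFun (fun k : Fin Ns => S (finProdFinEquiv (r, k))) P :=
      hind.precomp (g := fun k : Fin Ns => (r, k)) fun a b hab => (Prod.mk.inj hab).2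
    have h := measureReal_abs_mean_sub_ge_le (P := P) hNs
      (X := fun k ω => (G d (coeff d a) x (S (finProdFinEquiv (r, k)) ω)).re)
      (fun k => (measurable_G_re d _ x).comp (hm (r, k)))
      (hrow.comp (fun _ s => (G d (coeff d a) x s).re) fun _ => measurable_G_re d _ x)
      (fun k ω => abs_G_re_le d _ x _)
      (fun k => hS.integral_G_re_eq_smoothCdf hH hρ x _) hc
    refine h.trans ?_
    have : 0 < (Ns : ℝ) * c ^ 2 := by positivity
    rw [div_le_iff₀ this]
    nlinarith

end Batches

/-! ### Values and step counts of the programs -/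

namespace Timed

theorem bind_val {α β : Type} (m : Timed α) (f : α → Timed β) : (m >>= f).val = (f m.val).val := rfl

theorem bind_steps {α β : Type} (m : Timed α) (f : α → Timed β) :
    (m >>= f).steps = m.steps + (f m.val).steps := rfl

theorem lt_val_of_lt {a b : ℝ} (h : a < b) : (lt a b).val = true := by simp [lt, h]

theorem lt_val_of_not_lt {a b : ℝ} (h : ¬ a < b) : (lt a b).val = false := by
  simpa [lt] using h

theorem foldlM_val {α β : Type} (f : β → α → Timed β) (l : List α) (b : β) :
    (l.foldlM f b).val = l.foldl (fun b a => (f b a).val) b := by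
  induction l generalizing b with
  | nil => rfl
  | cons a l ih => rw [List.foldlM_cons, bind_val, ih, List.foldl_cons]

theorem foldlM_steps_le {α β : Type} (f : β → α → Timed β) {K : ℕ} (hK : ∀ b a, (f b a).steps ≤ K)
    (l : List α) (b : β) : (l.foldlM f b).steps ≤ l.length * K := by
  induction l generalizing b with
  | nil => simp [pure]
  | cons a l ih =>
    rw [List.foldlM_cons, bind_steps, List.length_cons, Nat.succ_mul, add_comm]
    exact Nat.add_le_add (ih _) (hK b a)

end Timed

theorem foldl_add_eq_sum {n : ℕ} (f : Fin n → ℝ) (b : ℝ) :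
    (List.finRange n).foldl (fun acc k => acc + f k) b = b + ∑ k, f k := by
  rw [← List.sum_ofFn, List.ofFn_eq_map]
  generalize List.finRange n = l
  induction l generalizing b with
  | nil => simp
  | cons a l ih => rw [List.foldl_cons, ih, List.map_cons, List.sum_cons, add_assoc]

section Programs

variable {Nb Ns : ℕ}

theorem batchMean_val (d : ℕ) (F : ℤ → ℂ) (S : Fin (Nb * Ns) → Sample) (x : ℝ) (r : Fin Nb) :
    (batchMean (tableOf d F) S x r).val
      = batchAverage d F x fun k : Fin Ns => S (finProdFinEquiv (r, k)) := by
  unfold batchMean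
  rw [Timed.bind_val, Timed.foldlM_val]
  have := foldl_add_eq_sum (fun k : Fin Ns => (G d F x (S (finProdFinEquiv (r, k)))).re) 0
  rw [zero_add] at this
  unfold batchAverage
  rw [← this]
  rfl

theorem batchMean_steps_le (tab : Table) (S : Fin (Nb * Ns) → Sample) (x : ℝ) (r : Fin Nb) :
    (batchMean tab S x r).steps ≤ Ns * 12 + 1 := by
  unfold batchMean
  rw [Timed.bind_steps]
  -- Per sample: loop control, one read, nine steps of `evalG`, and one addition.
  refine Nat.add_le_add ((Timed.foldlM_steps_le _ (K := 12) ?_ _ _).trans ?_) le_rfl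
  · exact fun b a => le_rfl
  · rw [List.length_finRange]

open Classical in
theorem certify_val (d : ℕ) (F : ℤ → ℂ) (η : ℝ) (S : Fin (Nb * Ns) → Sample) (x : ℝ) :
    (certify (tableOf d F) η S x).val
      = if (Nb : ℝ) / 2 < (Finset.univ.filter fun r : Fin Nb => 3 / 4 * η
          < batchAverage d F x fun k : Fin Ns => S (finProdFinEquiv (r, k))).card then 0 else 1 := by
  have hfold : ((List.finRange Nb).foldlM (fun (c : ℝ) (r : Fin Nb) => do
      Timed.loopControl
      let g ← batchMean (tableOf d F) S x r
      if ← Timed.lt (3 / 4 * η) g then Timed.add c 1 else pure c) 0).val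
      = ((Finset.univ.filter fun r : Fin Nb => 3 / 4 * η
          < batchAverage d F x fun k : Fin Ns => S (finProdFinEquiv (r, k))).card : ℝ) := by
    rw [Timed.foldlM_val]
    have h := foldl_add_eq_sum (fun r : Fin Nb => if 3 / 4 * η
          < batchAverage d F x (fun k : Fin Ns => S (finProdFinEquiv (r, k))) then (1 : ℝ) else 0) 0
    rw [zero_add] at h
    rw [Finset.card_filter]
    push_cast
    rw [← h]
    congr 1
    funext c r
    simp only [Timed.bind_val, Timed.lt, batchMean_val]
    by_cases h : 3 / 4 * η < batchAverage d F x fun k : Fin Ns => S (finProdFinEquiv (r, k))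
    · simp [h, Timed.add]
    · simp [h, pure]
  unfold certify
  simp only [Timed.bind_val]
  have hmul : (Timed.mul (3 / 4) η).val = 3 / 4 * η := rfl
  have hdiv : (Timed.div (Nb : ℝ) 2).val = Nb / 2 := rfl
  rw [hmul, hfold, hdiv]
  by_cases h : (Nb : ℝ) / 2 < (Finset.univ.filter fun r : Fin Nb => 3 / 4 * η
      < batchAverage d F x fun k : Fin Ns => S (finProdFinEquiv (r, k))).card
  · rw [if_pos h, Timed.lt_val_of_lt h]; rfl
  · rw [if_neg h, Timed.lt_val_of_not_lt h]; rfl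

theorem certify_steps_le (tab : Table) (η : ℝ) (S : Fin (Nb * Ns) → Sample) (x : ℝ) :
    (certify tab η S x).steps ≤ Nb * (Ns * 12 + 4) + 3 := by
  have hfold := Timed.foldlM_steps_le (fun (c : ℝ) (r : Fin Nb) => do
      Timed.loopControl
      let g ← batchMean tab S x r
      -- Besides the `12 Ns + 1` steps of the batch mean: loop control, a comparison, and at most
      -- one increment.
      if ← Timed.lt (3 / 4 * η) g then Timed.add c 1 else pure c) (K := Ns * 12 + 4) (by
    intro c r
    simp only [Timed.bind_steps]
    have h1 := batchMean_steps_le tab S x r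
    have h2 : ∀ b : Bool, (if b = true then Timed.add c 1 else pure c : Timed ℝ).steps ≤ 1 := by
      intro b; cases b <;> simp [Timed.add, pure]
    have h3 := h2 (Timed.lt (3 / 4 * η) (batchMean tab S x r).val).val
    have h4 : Timed.loopControl.steps = 1 := rfl
    have h5 : (Timed.lt (3 / 4 * η) (batchMean tab S x r).val).steps = 1 := rfl
    omega) (List.finRange Nb) 0
  rw [List.length_finRange] at hfold
  unfold certify
  simp only [Timed.bind_steps]
  have h1 : ∀ b : Bool, (if b = true then pure 0 else pure 1 : Timed (Fin 2)).steps = 0 := by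
    intro b; cases b <;> rfl
  rw [h1]
  have h2 : (Timed.mul (3 / 4) η).steps = 1 := rfl
  have h3 : ∀ a b : ℝ, (Timed.div a b).steps = 1 := fun _ _ => rfl
  have h4 : ∀ a b : ℝ, (Timed.lt a b).steps = 1 := fun _ _ => rfl
  rw [h2, h3, h4]
  have h5 : (Timed.mul (3 / 4) η).val = 3 / 4 * η := rfl
  rw [h5]
  omega

theorem searchLoop_of_le (tab : Table) {δ : ℝ} (η : ℝ) (S : Fin (Nb * Ns) → Sample) (fuel : ℕ)
    {x₀ x₁ : ℝ} (h : x₁ - x₀ ≤ 2 * δ) :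
    searchLoop tab δ η S (fuel + 1) x₀ x₁ = ⟨some ((x₀ + x₁) / 2), 6⟩ := by
  rw [searchLoop]
  have : (Timed.lt (2 * δ) (x₁ - x₀)).val = false := by simp [Timed.lt, h]
  simp only [bind, pure, Timed.loopControl, Timed.sub, Timed.mul, Timed.add, Timed.div, this]
  simp [Timed.lt]

theorem searchLoop_of_lt_left (tab : Table) {δ : ℝ} (η : ℝ) (S : Fin (Nb * Ns) → Sample) (fuel : ℕ)
    {x₀ x₁ : ℝ} (h : 2 * δ < x₁ - x₀) (hu : (certify tab η S ((x₀ + x₁) / 2)).val = 0) :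
    searchLoop tab δ η S (fuel + 1) x₀ x₁
      = ⟨(searchLoop tab δ η S fuel x₀ ((x₀ + x₁) / 2 + 2 / 3 * δ)).val,
        8 + (certify tab η S ((x₀ + x₁) / 2)).steps
          + (searchLoop tab δ η S fuel x₀ ((x₀ + x₁) / 2 + 2 / 3 * δ)).steps⟩ := by
  rw [searchLoop]
  have : (Timed.lt (2 * δ) (x₁ - x₀)).val = true := by simp [Timed.lt, h]
  simp only [bind, pure, Timed.loopControl, Timed.sub, Timed.mul, Timed.add, Timed.div, this]
  simp only [if_true, hu, Timed.lt]
  congr 1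
  ring

theorem searchLoop_of_lt_right (tab : Table) {δ : ℝ} (η : ℝ) (S : Fin (Nb * Ns) → Sample) (fuel : ℕ)
    {x₀ x₁ : ℝ} (h : 2 * δ < x₁ - x₀) (hu : (certify tab η S ((x₀ + x₁) / 2)).val = 1) :
    searchLoop tab δ η S (fuel + 1) x₀ x₁
      = ⟨(searchLoop tab δ η S fuel ((x₀ + x₁) / 2 - 2 / 3 * δ) x₁).val,
        8 + (certify tab η S ((x₀ + x₁) / 2)).steps
          + (searchLoop tab δ η S fuel ((x₀ + x₁) / 2 - 2 / 3 * δ) x₁).steps⟩ := by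
  rw [searchLoop]
  have : (Timed.lt (2 * δ) (x₁ - x₀)).val = true := by simp [Timed.lt, h]
  have h10 : ¬ ((1 : Fin 2) = 0) := by decide
  simp only [bind, pure, Timed.loopControl, Timed.sub, Timed.mul, Timed.add, Timed.div, this]
  simp only [if_true, hu, Timed.lt, if_neg h10]
  congr 1
  ring

end Programs

/-! ### The search -/

/-- The excess of the interval length over its limit `4δ/3` after `l` iterations. -/
noncomputable def gap (δ : ℝ) (l : ℕ) : ℝ := (2 * Real.pi / 3 - 4 / 3 * δ) / 2 ^ l

/-- An iteration changes the width by `w ↦ w / 2 + 2δ / 3`, whose fixed point is `4δ / 3`; the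
excess over it is halved. -/
theorem gap_succ (δ : ℝ) (l : ℕ) : gap δ (l + 1) = gap δ l / 2 := by
  unfold gap; rw [pow_succ]; field_simp

/-- If an invariant is maintained for `n` iterations, and the interval is then short enough, then
the search stops, and its output is the midpoint of an interval that satisfies the invariant. -/
theorem searchLoop_spec {Nb Ns : ℕ} (tab : Table) {δ : ℝ} (η : ℝ) (S : Fin (Nb * Ns) → Sample)
    (I : ℕ → ℝ → ℝ → Prop) {n : ℕ}
    (hwidth : ∀ l x₀ x₁, I l x₀ x₁ → x₁ - x₀ = 4 / 3 * δ + gap δ l)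
    (hleft : ∀ l < n, ∀ x₀ x₁, I l x₀ x₁ → (certify tab η S ((x₀ + x₁) / 2)).val = 0 →
      I (l + 1) x₀ ((x₀ + x₁) / 2 + 2 / 3 * δ))
    (hright : ∀ l < n, ∀ x₀ x₁, I l x₀ x₁ → (certify tab η S ((x₀ + x₁) / 2)).val = 1 →
      I (l + 1) ((x₀ + x₁) / 2 - 2 / 3 * δ) x₁)
    (hn : gap δ n ≤ 2 / 3 * δ) (m : ℕ) :
    ∀ l x₀ x₁, l + m = n → I l x₀ x₁ → ∃ l' y₀ y₁ t, I l' y₀ y₁ ∧ y₁ - y₀ ≤ 2 * δ ∧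
      searchLoop tab δ η S (m + 1) x₀ x₁ = ⟨some ((y₀ + y₁) / 2), t⟩ ∧
      t ≤ (m + 1) * (Nb * (Ns * 12 + 4) + 11) := by
  induction m with
  | zero =>
    -- At level `n` the interval is short enough; the one remaining unit of fuel pays for the test
    -- that stops the loop.
    intro l x₀ x₁ hl hI
    have hw := hwidth l x₀ x₁ hI
    rw [add_zero] at hl
    rw [hl] at hw
    have hle : x₁ - x₀ ≤ 2 * δ := by linarith
    exact ⟨l, x₀, x₁, 6, hI, hle, searchLoop_of_le tab η S 0 hle, by omega⟩
  | succ m ih =>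
    intro l x₀ x₁ hl hI
    rcases le_or_gt (x₁ - x₀) (2 * δ) with h | h
    · refine ⟨l, x₀, x₁, 6, hI, h, searchLoop_of_le tab η S (m + 1) h, ?_⟩
      rw [Nat.succ_mul]; omega
    · have hc := certify_steps_le tab η S ((x₀ + x₁) / 2)
      rcases Fin.exists_fin_two.1 ⟨(certify tab η S ((x₀ + x₁) / 2)).val, rfl⟩ with hu | hu
      · obtain ⟨l', y₀, y₁, t, h1, h2, h3, h4⟩ :=
          ih (l + 1) _ _ (by omega) (hleft l (by omega) x₀ x₁ hI hu)
        refine ⟨l', y₀, y₁, 8 + (certify tab η S ((x₀ + x₁) / 2)).steps + t, h1, h2, ?_, ?_⟩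
        · rw [searchLoop_of_lt_left tab η S (m + 1) h hu, h3]
        · rw [Nat.succ_mul]; omega
      · obtain ⟨l', y₀, y₁, t, h1, h2, h3, h4⟩ :=
          ih (l + 1) _ _ (by omega) (hright l (by omega) x₀ x₁ hI hu)
        refine ⟨l', y₀, y₁, 8 + (certify tab η S ((x₀ + x₁) / 2)).steps + t, h1, h2, ?_, ?_⟩
        · rw [searchLoop_of_lt_right tab η S (m + 1) h hu, h3]
        · rw [Nat.succ_mul]; omega

theorem exists_outputs {Nb Ns : ℕ} (tab : Table) {δ : ℝ} (η : ℝ) (S : Fin (Nb * Ns) → Sample) {n : ℕ}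
    (hn : gap δ n ≤ 2 / 3 * δ) :
    ∃ x t, Outputs tab δ η S x t ∧ t ≤ (n + 1) * (Nb * (Ns * 12 + 4) + 11) := by
  obtain ⟨l', y₀, y₁, t, -, -, h, ht⟩ := searchLoop_spec tab η S
    (fun l x₀ x₁ => x₁ - x₀ = 4 / 3 * δ + gap δ l) (n := n) (fun _ _ _ h => h)
    (fun l _ x₀ x₁ h _ => by rw [gap_succ]; linarith)
    (fun l _ x₀ x₁ h _ => by rw [gap_succ]; linarith) hn n 0 (-(Real.pi / 3)) (Real.pi / 3)
    (zero_add n) (by unfold gap; rw [pow_zero]; ring)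
  exact ⟨_, t, ⟨n + 1, h⟩, ht⟩

/-! ### The two extremal search paths and the invariant between them. -/

section Paths

variable (C : ℝ → ℝ) (δ η : ℝ)

/-- The midpoints of the search that moves to the left whenever this is permitted. -/
noncomputable def leftPath : ℕ → ℝ
  | 0 => 0
  | l + 1 => open Classical in
    if η / 2 < C (leftPath l + 2 / 3 * δ) then leftPath l - gap δ l / 4 else leftPath l + gap δ l / 4

/-- The midpoints of the search that moves to the right whenever this is permitted. -/
noncomputable def rightPath : ℕ → ℝ
  | 0 => 0
  | l + 1 => open Classical in
    if C (rightPath l - 2 / 3 * δ) < η then rightPath l + gap δ l / 4 else rightPath l - gap δ l / 4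

variable {C δ η}

theorem gap_nonneg (hδ : δ < Real.pi / 6) (l : ℕ) : 0 ≤ gap δ l := by
  unfold gap
  have := Real.pi_pos
  exact div_nonneg (by linarith) (by positivity)

theorem leftPath_succ_le (hδ : δ < Real.pi / 6) (l : ℕ) :
    leftPath C δ η (l + 1) ≤ leftPath C δ η l + gap δ l / 4 := by
  rw [leftPath]
  have := gap_nonneg hδ l
  split_ifs <;> linarith

theorem le_leftPath_succ (hδ : δ < Real.pi / 6) (l : ℕ) :
    leftPath C δ η l - gap δ l / 4 ≤ leftPath C δ η (l + 1) := by
  rw [leftPath]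
  have := gap_nonneg hδ l
  split_ifs <;> linarith

theorem rightPath_succ_le (hδ : δ < Real.pi / 6) (l : ℕ) :
    rightPath C δ η (l + 1) ≤ rightPath C δ η l + gap δ l / 4 := by
  rw [rightPath]
  have := gap_nonneg hδ l
  split_ifs <;> linarith

theorem le_rightPath_succ (hδ : δ < Real.pi / 6) (l : ℕ) :
    rightPath C δ η l - gap δ l / 4 ≤ rightPath C δ η (l + 1) := by
  rw [rightPath]
  have := gap_nonneg hδ l
  split_ifs <;> linarith

theorem abs_leftPath_le (hδ : δ < Real.pi / 6) (l : ℕ) :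
    |leftPath C δ η l| ≤ Real.pi / 3 - (2 / 3 * δ + gap δ l / 2) := by
  induction l with
  | zero => unfold leftPath gap; rw [pow_zero, abs_zero]; linarith
  | succ l ih =>
    have h1 := leftPath_succ_le (C := C) (η := η) hδ l
    have h2 := le_leftPath_succ (C := C) (η := η) hδ l
    have h3 := abs_le.1 ih
    rw [gap_succ, abs_le]
    constructor <;> linarith

theorem abs_rightPath_le (hδ : δ < Real.pi / 6) (l : ℕ) :
    |rightPath C δ η l| ≤ Real.pi / 3 - (2 / 3 * δ + gap δ l / 2) := by
  induction l with
  | zero => unfold rightPath gap; rw [pow_zero, abs_zero]; linarith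
  | succ l ih =>
    have h1 := rightPath_succ_le (C := C) (η := η) hδ l
    have h2 := le_rightPath_succ (C := C) (η := η) hδ l
    have h3 := abs_le.1 ih
    rw [gap_succ, abs_le]
    constructor <;> linarith

/-- The point is the right end of the interval around the path. It starts at `π / 3`, a move to the
left replaces it only under the tested condition, and a move to the right keeps it. -/
theorem lt_cdf_leftPath (hC : η / 2 < C (Real.pi / 3)) (l : ℕ) :
    η / 2 < C (leftPath C δ η l + (2 / 3 * δ + gap δ l / 2)) := by
  induction l with
  | zero =>
    have : leftPath C δ η 0 + (2 / 3 * δ + gap δ 0 / 2) = Real.pi / 3 := by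
      unfold leftPath gap; rw [pow_zero]; ring
    rwa [this]
  | succ l ih =>
    rw [leftPath, gap_succ]
    split_ifs with h
    · convert h using 2; ring
    · convert ih using 2; ring

theorem cdf_rightPath_lt (hC : C (-(Real.pi / 3)) < η) (l : ℕ) :
    C (rightPath C δ η l - (2 / 3 * δ + gap δ l / 2)) < η := by
  induction l with
  | zero =>
    have : rightPath C δ η 0 - (2 / 3 * δ + gap δ 0 / 2) = -(Real.pi / 3) := by
      unfold rightPath gap; rw [pow_zero]; ring
    rwa [this]
  | succ l ih =>
    rw [rightPath, gap_succ]
    split_ifs with h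
    · convert h using 2; ring
    · convert ih using 2; ring

variable (C δ η) in
/-- The invariant of the search: the interval brackets a solution, and its midpoint lies on the
leftmost path or beyond the right neighbour of it in the grid of midpoints, and symmetrically. -/
structure Bracket (l : ℕ) (x₀ x₁ : ℝ) : Prop where
  width : x₁ - x₀ = 4 / 3 * δ + gap δ l
  left_mem : -(Real.pi / 3) ≤ x₀
  right_mem : x₁ ≤ Real.pi / 3
  left_lt : C x₀ < η
  lt_right : η / 2 < C x₁
  left_path : (x₀ + x₁) / 2 = leftPath C δ η l ∨ leftPath C δ η l + gap δ l ≤ (x₀ + x₁) / 2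
  right_path : (x₀ + x₁) / 2 = rightPath C δ η l ∨ (x₀ + x₁) / 2 ≤ rightPath C δ η l - gap δ l

variable (h0 : 0 < δ) (hδ : δ < Real.pi / 6)
  (hmono : MonotoneOn C (Set.Icc (-(2 * Real.pi / 3)) (2 * Real.pi / 3)))

include h0 hδ hmono

/-- `CERTIFY` has to be trusted only when the midpoint lies on the left path. Anywhere further right
the move is justified by monotonicity, whatever the samples say. -/
theorem Bracket.move_left {l : ℕ} {x₀ x₁ : ℝ} (h : Bracket C δ η l x₀ x₁)
    (hC : η / 2 < C (Real.pi / 3))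
    (hgood : (x₀ + x₁) / 2 = leftPath C δ η l → η / 2 < C (leftPath C δ η l + 2 / 3 * δ)) :
    Bracket C δ η (l + 1) x₀ ((x₀ + x₁) / 2 + 2 / 3 * δ) := by
  obtain ⟨hw, hm0, hm1, hl, hr, hL, hR⟩ := h
  have hpi := Real.pi_pos
  have hg := gap_nonneg hδ l
  have hL1 := leftPath_succ_le (C := C) (η := η) hδ l
  have hR2 := le_rightPath_succ (C := C) (η := η) hδ l
  have habs := abs_le.1 (abs_leftPath_le (C := C) (η := η) hδ l)
  have hnew : (x₀ + ((x₀ + x₁) / 2 + 2 / 3 * δ)) / 2 = (x₀ + x₁) / 2 - gap δ l / 4 := by linarith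
  have hlt : η / 2 < C ((x₀ + x₁) / 2 + 2 / 3 * δ) := by
    rcases hL with hL | hL
    · rw [hL]; exact hgood hL
    -- The midpoint is at least a whole gap to the right of the path, so the new right end lies
    -- beyond the right end of the path's interval, which is only half a gap away.
    · refine lt_of_lt_of_le (lt_cdf_leftPath (δ := δ) hC l) (hmono ⟨?_, ?_⟩ ⟨?_, ?_⟩ ?_) <;> linarith
  refine ⟨by rw [gap_succ]; linarith, hm0, by linarith, hl, hlt, ?_, ?_⟩
  · rw [hnew, gap_succ]
    rcases hL with hL | hL
    · left
      rw [leftPath, if_pos (hgood hL), hL]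
    · right; linarith
  · rw [hnew, gap_succ]
    rcases hR with hR | hR
    · rw [rightPath, hR]
      -- If the right path goes right while the search goes left, they separate by half the old gap,
      -- which is exactly the new gap; otherwise they stay together.
      split_ifs
      · right; linarith
      · left; rfl
    · right; linarith

theorem Bracket.move_right {l : ℕ} {x₀ x₁ : ℝ} (h : Bracket C δ η l x₀ x₁)
    (hC : C (-(Real.pi / 3)) < η)
    (hgood : (x₀ + x₁) / 2 = rightPath C δ η l → C (rightPath C δ η l - 2 / 3 * δ) < η) :
    Bracket C δ η (l + 1) ((x₀ + x₁) / 2 - 2 / 3 * δ) x₁ := by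
  obtain ⟨hw, hm0, hm1, hl, hr, hL, hR⟩ := h
  have hpi := Real.pi_pos
  have hg := gap_nonneg hδ l
  have hL2 := leftPath_succ_le (C := C) (η := η) hδ l
  have hR1 := le_rightPath_succ (C := C) (η := η) hδ l
  have habs := abs_le.1 (abs_rightPath_le (C := C) (η := η) hδ l)
  have hnew : ((x₀ + x₁) / 2 - 2 / 3 * δ + x₁) / 2 = (x₀ + x₁) / 2 + gap δ l / 4 := by linarith
  have hlt : C ((x₀ + x₁) / 2 - 2 / 3 * δ) < η := by
    rcases hR with hR | hR
    · rw [hR]; exact hgood hR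
    · refine lt_of_le_of_lt (hmono ⟨?_, ?_⟩ ⟨?_, ?_⟩ ?_) (cdf_rightPath_lt (δ := δ) hC l) <;> linarith
  refine ⟨by rw [gap_succ]; linarith, by linarith, hm1, hlt, hr, ?_, ?_⟩
  · rw [hnew, gap_succ]
    rcases hL with hL | hL
    · rw [leftPath, hL]
      split_ifs
      · right; linarith
      · left; rfl
    · right; linarith
  · rw [hnew, gap_succ]
    rcases hR with hR | hR
    · left
      rw [rightPath, if_pos (hgood hR), hR]
    · right; linarith

/-- Both ends are within `δ` of the midpoint, so monotonicity carries the inequalities from the ends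
to the midpoint shifted by `±δ`. -/
theorem Bracket.solves {l : ℕ} {x₀ x₁ : ℝ} (h : Bracket C δ η l x₀ x₁) (hle : x₁ - x₀ ≤ 2 * δ) :
    Solves δ η C ((x₀ + x₁) / 2) := by
  obtain ⟨hw, hm0, hm1, hl, hr, -, -⟩ := h
  have hpi := Real.pi_pos
  have hg := gap_nonneg hδ l
  refine ⟨⟨by linarith, by linarith⟩, ?_, ?_⟩
  · refine lt_of_lt_of_le hr (hmono ⟨?_, ?_⟩ ⟨?_, ?_⟩ ?_) <;> linarith
  · refine lt_of_le_of_lt (hmono ⟨?_, ?_⟩ ⟨?_, ?_⟩ ?_) hl <;> linarith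

/-- The search succeeds if `CERTIFY` is right at the midpoints of the two extremal paths. -/
theorem exists_outputs_solves {Nb Ns : ℕ} (tab : Table) (S : Fin (Nb * Ns) → Sample) {n : ℕ}
    (hn : gap δ n ≤ 2 / 3 * δ) (hC : η / 2 < C (Real.pi / 3)) (hC' : C (-(Real.pi / 3)) < η)
    (hgoodL : ∀ l < n, (certify tab η S (leftPath C δ η l)).val = 0 →
      η / 2 < C (leftPath C δ η l + 2 / 3 * δ))
    (hgoodR : ∀ l < n, (certify tab η S (rightPath C δ η l)).val = 1 →
      C (rightPath C δ η l - 2 / 3 * δ) < η) :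
    ∃ x t, Outputs tab δ η S x t ∧ Solves δ η C x := by
  obtain ⟨l', y₀, y₁, t, hI, hle, h, -⟩ := searchLoop_spec tab η S (Bracket C δ η) (n := n)
    (fun _ _ _ h => h.width)
    (fun l hl x₀ x₁ h hu => h.move_left h0 hδ hmono hC fun he => hgoodL l hl (he ▸ hu))
    (fun l hl x₀ x₁ h hu => h.move_right h0 hδ hmono hC' fun he => hgoodR l hl (he ▸ hu))
    hn n 0 (-(Real.pi / 3)) (Real.pi / 3) (zero_add n)
    ⟨by unfold gap; rw [pow_zero]; ring, le_rfl, le_rfl, hC', hC,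
      Or.inl (by simp [leftPath]), Or.inl (by simp [rightPath])⟩
  exact ⟨_, t, ⟨n + 1, h⟩, hI.solves h0 hδ hmono hle⟩

end Paths

/-! ### The success probability -/

section Success

variable {ι : Type*} [Fintype ι] [DecidableEq ι] {H ρ : Matrix ι ι ℂ} {τ δ η : ℝ} {d Nb Ns : ℕ}

open Classical in
/-- The number of batches whose mean deviates from `y` by at least `c`. -/
noncomputable def badCount (d : ℕ) (F : ℤ → ℂ) (c x y : ℝ) (s : Fin (Nb * Ns) → Sample) : ℕ :=
  (Finset.univ.filter fun r : Fin Nb =>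
    c ≤ |batchAverage d F x (fun k : Fin Ns => s (finProdFinEquiv (r, k))) - y|).card

/-- Pigeonhole: the batches above the threshold outnumber the inaccurate ones, so some accurate
batch is above the threshold. -/
theorem lt_of_certify_eq_zero {F : ℤ → ℂ} {c x y : ℝ} {s : Fin (Nb * Ns) → Sample}
    (hs : badCount d F c x y s < (Nb : ℝ) / 2) (h : (certify (tableOf d F) η s x).val = 0) :
    3 / 4 * η - c < y := by
  classical
  rw [certify_val] at h
  split_ifs at h with hlt
  swap
  · exact absurd h (by decide)
  have hcard : badCount d F c x y s < (Finset.univ.filter fun r : Fin Nb => 3 / 4 * η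
      < batchAverage d F x fun k : Fin Ns => s (finProdFinEquiv (r, k))).card := by
    exact_mod_cast hs.trans hlt
  obtain ⟨r, hr, hr'⟩ := Finset.exists_mem_notMem_of_card_lt_card hcard
  have h1 := (Finset.mem_filter.1 hr).2
  have h2 : ¬ c ≤ |batchAverage d F x (fun k : Fin Ns => s (finProdFinEquiv (r, k))) - y| :=
    fun h => hr' (Finset.mem_filter.2 ⟨Finset.mem_univ _, h⟩)
  have h3 := abs_lt.1 (not_le.1 h2)
  linarith

theorem lt_of_certify_eq_one {F : ℤ → ℂ} {c x y : ℝ} {s : Fin (Nb * Ns) → Sample}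
    (hs : badCount d F c x y s < (Nb : ℝ) / 2) (h : (certify (tableOf d F) η s x).val = 1) :
    y < 3 / 4 * η + c := by
  classical
  rw [certify_val] at h
  split_ifs at h with hlt
  · exact absurd h (by decide)
  have hsum := Finset.card_filter_add_card_filter_not (s := (Finset.univ : Finset (Fin Nb)))
    (fun r : Fin Nb => 3 / 4 * η
      < batchAverage d F x fun k : Fin Ns => s (finProdFinEquiv (r, k)))
  rw [Finset.card_univ, Fintype.card_fin] at hsum
  have hcard : badCount d F c x y s < (Finset.univ.filter fun r : Fin Nb => ¬ 3 / 4 * η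
      < batchAverage d F x fun k : Fin Ns => s (finProdFinEquiv (r, k))).card := by
    -- A tie also gives the answer 1, so the batches not above the threshold may be exactly half.
    -- This is why fewer than half must be inaccurate, strictly.
    have hsum' := congrArg (Nat.cast (R := ℝ)) hsum
    push_cast at hsum'
    have : (badCount d F c x y s : ℝ) < (Finset.univ.filter fun r : Fin Nb => ¬ 3 / 4 * η
      < batchAverage d F x fun k : Fin Ns => s (finProdFinEquiv (r, k))).card := by linarith
    exact_mod_cast this
  obtain ⟨r, hr, hr'⟩ := Finset.exists_mem_notMem_of_card_lt_card hcard
  have h1 := (Finset.mem_filter.1 hr).2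
  have h2 : ¬ c ≤ |batchAverage d F x (fun k : Fin Ns => s (finProdFinEquiv (r, k))) - y| :=
    fun h => hr' (Finset.mem_filter.2 ⟨Finset.mem_univ _, h⟩)
  have h3 := abs_lt.1 (not_le.1 h2)
  linarith

theorem IsSampleFamily.le_measureReal_solves {Ω : Type*} [MeasurableSpace Ω] {P : Measure Ω}
    [IsProbabilityMeasure P] {S : Fin (Nb * Ns) → Ω → Sample}
    (hS : IsSampleFamily d (coeff d (2 / 3 * δ)) H ρ τ P S) (hH : H.IsHermitian)
    (hρ : IsDensityMatrix ρ) (hτ : ∀ i, |τ * hH.eigenvalues i| < Real.pi / 3)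
    (h0 : 0 < δ) (hδ : δ < Real.pi / 6) (hη : 0 < η) (hη1 : η < 1)
    (hN : 0 < ∫ y in (-Real.pi)..Real.pi, bump d (2 / 3 * δ) y)
    (hε : 2 * Real.pi / (∫ y in (-Real.pi)..Real.pi, bump d (2 / 3 * δ) y) ≤ η / 9)
    {n : ℕ} (hn : gap δ n ≤ 2 / 3 * δ) (hNs : 0 < Ns)
    (hbig : 16 * totalWeight d (coeff d (2 / 3 * δ)) ^ 2 ≤ Ns * (η / 9) ^ 2) {ϑ : ℝ}
    (hϑ : 2 * n * Real.exp (-(Nb / 8)) ≤ ϑ) :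
    1 - ϑ ≤ P.real {ω | ∃ (x : ℝ) (t : ℕ),
      Outputs (tableOf d (coeff d (2 / 3 * δ))) δ η (fun k => S k ω) x t ∧
      Solves δ η (cdf hH ρ τ) x} := by
  have hpi := Real.pi_pos
  set F := coeff d (2 / 3 * δ) with hF
  set C := cdf hH ρ τ with hCdef
  set bad : ℝ → Set Ω := fun x => {ω | (Nb : ℝ) / 2
    ≤ badCount d F (η / 9) x (smoothCdf hH d (2 / 3 * δ) ρ τ x) fun k => S k ω} with hbad
  have hprob : ∀ x, P.real (bad x) ≤ Real.exp (-(Nb / 8)) := fun x =>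
    hS.measureReal_bad_majority_le hH hρ x (by positivity) hNs hbig
  -- Both paths are determined by `C`, `δ` and `η` alone, so a fixed-point bound applies at each of
  -- these `2n` points although the search itself is adaptive.
  set B : Set Ω := ⋃ l ∈ Finset.range n, (bad (leftPath C δ η l) ∪ bad (rightPath C δ η l))
  have hB : P.real B ≤ ϑ := by
    refine (measureReal_biUnion_finset_le _ _).trans (le_trans ?_ hϑ)
    calc ∑ l ∈ Finset.range n, P.real (bad (leftPath C δ η l) ∪ bad (rightPath C δ η l))
        ≤ ∑ _l ∈ Finset.range n, 2 * Real.exp (-(Nb / 8)) := by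
          refine Finset.sum_le_sum fun l _ => (measureReal_union_le _ _).trans ?_
          linarith [hprob (leftPath C δ η l), hprob (rightPath C δ η l)]
      _ = 2 * n * Real.exp (-(Nb / 8)) := by simp; ring
  set A : Set Ω := {ω | ∃ (x : ℝ) (t : ℕ),
    Outputs (tableOf d F) δ η (fun k => S k ω) x t ∧ Solves δ η C x}
  have hsub : Bᶜ ⊆ A := by
    intro ω hω
    have hω' : ∀ l < n, ω ∉ bad (leftPath C δ η l) ∧ ω ∉ bad (rightPath C δ η l) := by
      intro l hl
      constructor
      · exact fun h => hω (Set.mem_biUnion (Finset.mem_coe.2 (Finset.mem_range.2 hl)) (Or.inl h))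
      · exact fun h => hω (Set.mem_biUnion (Finset.mem_coe.2 (Finset.mem_range.2 hl)) (Or.inr h))
    have habsL : ∀ l, |leftPath C δ η l| ≤ Real.pi / 3 := fun l =>
      (abs_leftPath_le hδ l).trans (by linarith [gap_nonneg hδ l])
    have habsR : ∀ l, |rightPath C δ η l| ≤ Real.pi / 3 := fun l =>
      (abs_rightPath_le hδ l).trans (by linarith [gap_nonneg hδ l])
    refine exists_outputs_solves h0 hδ (cdf_mono hH hρ hτ) (tableOf d F) (fun k => S k ω) hn
      ?_ ?_ (fun l hl hu => ?_) fun l hl hu => ?_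
    · rw [cdf_right hH hρ hτ]; linarith
    · rw [cdf_left hH hτ]; exact hη
    -- Statistical and smoothing errors are `η / 9` each: `3/4 - 2/9 = 19/36 > 1/2` here, and `3/4 +
    -- 2/9 = 35/36 < 1` in the other case.
    · have h1 := lt_of_certify_eq_zero (not_le.1 (hω' l hl).1) hu
      have h2 := smoothCdf_le hH (a := 2 / 3 * δ) (by linarith) (by linarith) hN hε hρ hτ (habsL l)
      linarith
    · have h1 := lt_of_certify_eq_one (not_le.1 (hω' l hl).2) hu
      have h2 := le_smoothCdf hH (a := 2 / 3 * δ) (by linarith) (by linarith) hN hε hρ hτ (habsR l)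
      linarith
  -- Subadditivity is used instead of complements, so the success event need not be shown
  -- measurable.
  have h1 : 1 ≤ P.real B + P.real A := by
    have : P.real (Set.univ : Set Ω) ≤ P.real (B ∪ A) := measureReal_mono fun ω _ => by
      by_cases h : ω ∈ B
      · exact Or.inl h
      · exact Or.inr (hsub h)
    rw [probReal_univ] at this
    exact this.trans (measureReal_union_le _ _)
  linarith

end Success

/-! ### The choice of the parameters -/

section Parameters

variable {δ η : ℝ} (h0 : 0 < δ) (hδ : δ < Real.pi / 6)

include h0 hδ in
theorem log_inv_ge : 0.64 ≤ Real.log δ⁻¹ := by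
  have hpi := Real.pi_lt_d2
  have h := Real.one_sub_inv_le_log_of_pos (x := δ⁻¹ / 2) (by positivity)
  rw [Real.log_div (by positivity) (by norm_num), inv_div, div_inv_eq_mul] at h
  linarith [Real.log_two_gt_d9]

theorem log_log_ge {L : ℝ} (hL : 0.64 ≤ L) : -0.5 ≤ Real.log L := by
  have h := Real.one_sub_inv_le_log_of_pos (x := (0.8 : ℝ)) (by norm_num)
  have h2 : Real.log 0.64 = 2 * Real.log 0.8 := by
    rw [show (0.64 : ℝ) = 0.8 ^ 2 by norm_num, Real.log_pow]; norm_num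
  have h3 : Real.log 0.64 ≤ Real.log L := Real.log_le_log (by norm_num) hL
  norm_num at h
  linarith

theorem log_two_mul_inv_ge {ϑ : ℝ} (hϑ : 0 < ϑ) (hϑ1 : ϑ < 1) : 0.69 ≤ Real.log (2 * ϑ⁻¹) := by
  have h1 : 1 ≤ ϑ⁻¹ := (one_le_inv₀ hϑ).2 hϑ1.le
  have : Real.log 2 ≤ Real.log (2 * ϑ⁻¹) := Real.log_le_log (by norm_num) (by linarith)
  linarith [Real.log_two_gt_d9]

theorem exp_three_ge : 20 ≤ Real.exp 3 := by
  have h := Real.exp_one_gt_d9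
  have : Real.exp 3 = Real.exp 1 ^ 3 := by rw [← Real.exp_nat_mul]; norm_num
  rw [this]
  calc (20 : ℝ) ≤ 2.7182818283 ^ 3 := by norm_num
    _ ≤ Real.exp 1 ^ 3 := by gcongr

/-- The degree of the Chebyshev polynomial. -/
noncomputable def degree (δ η : ℝ) : ℕ := ⌈50 * (δ⁻¹ * Real.log (δ⁻¹ * η⁻¹))⌉₊

/-- A bound for the number of iterations of the search. -/
noncomputable def iterations (δ : ℝ) : ℕ := ⌈8 * Real.log δ⁻¹⌉₊

/-- The number of batches. -/
noncomputable def batches (δ ϑ : ℝ) : ℕ :=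
  ⌈8 * (3 + (Real.log (Real.log δ⁻¹) + Real.log (2 * ϑ⁻¹)))⌉₊

/-- The number of samples in a batch. -/
noncomputable def batchSize (δ η : ℝ) : ℕ :=
  ⌈32400 * (η⁻¹ ^ 2 * Real.log (degree δ η) ^ 2)⌉₊

theorem ceil_le_add_one_of_nonneg {x : ℝ} (hx : 0 ≤ x) : (⌈x⌉₊ : ℝ) ≤ x + 1 :=
  (Nat.ceil_lt_add_one hx).le

include h0 hδ in
theorem inv_ge : 1.9 ≤ δ⁻¹ := by
  have hpi := Real.pi_lt_d2
  rw [le_inv_comm₀ (by norm_num) h0]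
  norm_num
  linarith

include h0 hδ in
theorem iterations_le : (iterations δ : ℝ) ≤ 10 * Real.log δ⁻¹ := by
  have hL := log_inv_ge h0 hδ
  refine (ceil_le_add_one_of_nonneg (by linarith)).trans ?_
  linarith

include h0 hδ in
theorem gap_iterations_le : gap δ (iterations δ) ≤ 2 / 3 * δ := by
  have hpi := Real.pi_lt_d2
  have hpi0 := Real.pi_pos
  have hinv := inv_ge h0 hδ
  have hpow : Real.exp ((iterations δ : ℝ) / 2) ≤ 2 ^ iterations δ := by
    have : (2 : ℝ) ^ iterations δ = Real.exp (iterations δ * Real.log 2) := by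
      rw [Real.exp_nat_mul, Real.exp_log (by norm_num)]
    rw [this]
    apply Real.exp_le_exp.2
    have : (0 : ℝ) ≤ iterations δ := Nat.cast_nonneg _
    nlinarith [Real.log_two_gt_d9]
  have hceil : 8 * Real.log δ⁻¹ ≤ iterations δ := Nat.le_ceil _
  have h4 : δ⁻¹ ^ 4 ≤ 2 ^ iterations δ := by
    refine le_trans ?_ hpow
    have : δ⁻¹ ^ 4 = Real.exp (4 * Real.log δ⁻¹) := by
      rw [show (4 : ℝ) = ((4 : ℕ) : ℝ) by norm_num, Real.exp_nat_mul,
        Real.exp_log (by positivity)]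
    rw [this]
    -- The count `8 log δ⁻¹` is chosen so that even the crude bound `2 ^ n ≥ exp (n / 2)` yields
    -- `δ⁻¹ ^ 4`.
    exact Real.exp_le_exp.2 (by linarith)
  unfold gap
  rw [div_le_iff₀ (by positivity)]
  have h5 : 2 / 3 * δ * δ⁻¹ ^ 4 ≤ 2 / 3 * δ * 2 ^ iterations δ := by gcongr
  have h6 : 2 / 3 * δ * δ⁻¹ ^ 4 = 2 / 3 * δ⁻¹ ^ 3 := by field_simp
  have h7 : 6.8 ≤ δ⁻¹ ^ 3 := le_trans (by norm_num) (pow_le_pow_left₀ (by norm_num) hinv 3)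
  linarith

variable (hη : 0 < η) (hη1 : η < 1)

include h0 hη in
theorem log_inv_mul_inv : Real.log (δ⁻¹ * η⁻¹) = Real.log δ⁻¹ + Real.log η⁻¹ :=
  Real.log_mul (by positivity) (by positivity)

include hη hη1 in
theorem log_inv_nonneg : 0 ≤ Real.log η⁻¹ := Real.log_nonneg ((one_le_inv₀ hη).2 hη1.le)

include h0 hδ hη hη1

theorem log_inv_mul_inv_ge : 0.64 ≤ Real.log (δ⁻¹ * η⁻¹) := by
  rw [log_inv_mul_inv h0 hη]
  linarith [log_inv_ge h0 hδ, log_inv_nonneg hη hη1]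

theorem degree_le : (degree δ η : ℝ) ≤ 51 * (δ⁻¹ * Real.log (δ⁻¹ * η⁻¹)) := by
  have h1 := inv_ge h0 hδ
  have h2 := log_inv_mul_inv_ge h0 hδ hη hη1
  have h3 : 1 ≤ δ⁻¹ * Real.log (δ⁻¹ * η⁻¹) := by nlinarith
  refine (ceil_le_add_one_of_nonneg (by linarith)).trans ?_
  linarith

theorem degree_ge : 50 ≤ (degree δ η : ℝ) := by
  have h1 := inv_ge h0 hδ
  have h2 := log_inv_mul_inv_ge h0 hδ hη hη1
  have h3 : 1 ≤ δ⁻¹ * Real.log (δ⁻¹ * η⁻¹) := by nlinarith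
  refine le_trans ?_ (Nat.le_ceil _)
  linarith

theorem one_le_log_degree : 1 ≤ Real.log (degree δ η) := by
  have h := degree_ge h0 hδ hη hη1
  rw [Real.le_log_iff_exp_le (by linarith)]
  linarith [Real.exp_one_lt_three]

/-- The degree is at most `64 δ⁻¹ X` with `X = log (δ⁻¹ η⁻¹)`. Its logarithm is at most `6 log 2 +
2X - 1`, and the constant is absorbed since `X ≥ 0.64`. -/
theorem log_degree_le : Real.log (degree δ η) ≤ 9 * Real.log (δ⁻¹ * η⁻¹) := by
  have h := degree_ge h0 hδ hη hη1
  have h2 := log_inv_mul_inv_ge h0 hδ hη hη1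
  have h3 : Real.log (degree δ η) ≤ Real.log (64 * (δ⁻¹ * Real.log (δ⁻¹ * η⁻¹))) := by
    refine Real.log_le_log (by linarith) ((degree_le h0 hδ hη hη1).trans ?_)
    have : 0 ≤ δ⁻¹ * Real.log (δ⁻¹ * η⁻¹) := by positivity
    linarith
  rw [Real.log_mul (by norm_num) (by positivity), Real.log_mul (by positivity) (by positivity),
    show (64 : ℝ) = 2 ^ 6 by norm_num, Real.log_pow] at h3
  have h4 := Real.log_le_sub_one_of_pos (x := Real.log (δ⁻¹ * η⁻¹)) (by linarith)
  have h5 := log_inv_mul_inv h0 hη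
  have h6 := log_inv_nonneg hη hη1
  have h7 := Real.log_two_lt_d9
  push_cast at h3
  linarith

/-- With `X = log (δ⁻¹ η⁻¹)` the exponent is at least `11 X ≥ 6 + X`, so the exponential is at least
`60 π δ⁻¹ η⁻¹`. The factor `δ⁻¹` pays for the width of the window, leaving `20 π η⁻¹`, from which
the negative part removes at most `2π ≤ 2π η⁻¹`. -/
theorem integral_bump_degree_ge : 18 * Real.pi * η⁻¹
    ≤ ∫ y in (-Real.pi)..Real.pi, bump (degree δ η) (2 / 3 * δ) y := by
  have hpi0 := Real.pi_pos
  have hpi := Real.pi_lt_d2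
  have hX := log_inv_mul_inv_ge h0 hδ hη hη1
  have h := integral_bump_ge (d := degree δ η) (a := 2 / 3 * δ) (by linarith) (by linarith)
  refine le_trans ?_ h
  have hd : 50 * (δ⁻¹ * Real.log (δ⁻¹ * η⁻¹)) ≤ degree δ η := Nat.le_ceil _
  have hexp : 11 * Real.log (δ⁻¹ * η⁻¹) ≤ degree δ η * (2 / 3 * δ / 3) := by
    have h1 : 50 * (δ⁻¹ * Real.log (δ⁻¹ * η⁻¹)) * (2 / 3 * δ / 3)
        ≤ degree δ η * (2 / 3 * δ / 3) := by gcongr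
    have h2 : 50 * (δ⁻¹ * Real.log (δ⁻¹ * η⁻¹)) * (2 / 3 * δ / 3)
        = 100 / 9 * Real.log (δ⁻¹ * η⁻¹) := by field_simp; ring
    linarith
  have h6 : 60 * Real.pi * (δ⁻¹ * η⁻¹) ≤ Real.exp (degree δ η * (2 / 3 * δ / 3)) := by
    have h7 : Real.exp (6 + Real.log (δ⁻¹ * η⁻¹)) ≤ Real.exp (degree δ η * (2 / 3 * δ / 3)) :=
      Real.exp_le_exp.2 (by linarith)
    refine le_trans ?_ h7
    rw [Real.exp_add, Real.exp_log (by positivity)]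
    gcongr
    have h8 : Real.exp 6 = Real.exp 3 * Real.exp 3 := by rw [← Real.exp_add]; norm_num
    have h9 := exp_three_ge
    rw [h8]
    nlinarith
  have h10 : 2 / 3 * δ * (60 * Real.pi * (δ⁻¹ * η⁻¹) / 2)
      ≤ 2 / 3 * δ * (Real.exp (degree δ η * (2 / 3 * δ / 3)) / 2) := by gcongr
  have h11 : 2 / 3 * δ * (60 * Real.pi * (δ⁻¹ * η⁻¹) / 2) = 20 * Real.pi * η⁻¹ := by
    field_simp; ring
  have h12 : 1 ≤ η⁻¹ := (one_le_inv₀ hη).2 hη1.le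
  nlinarith

theorem integral_bump_degree_pos :
    0 < ∫ y in (-Real.pi)..Real.pi, bump (degree δ η) (2 / 3 * δ) y :=
  lt_of_lt_of_le (by have := Real.pi_pos; positivity) (integral_bump_degree_ge h0 hδ hη hη1)

theorem two_pi_div_integral_bump_le :
    2 * Real.pi / (∫ y in (-Real.pi)..Real.pi, bump (degree δ η) (2 / 3 * δ) y) ≤ η / 9 := by
  have hpi0 := Real.pi_pos
  rw [div_le_iff₀ (integral_bump_degree_pos h0 hδ hη hη1)]
  have h := integral_bump_degree_ge h0 hδ hη hη1
  calc 2 * Real.pi = η / 9 * (18 * Real.pi * η⁻¹) := by field_simp; norm_num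
    _ ≤ _ := by gcongr

theorem totalWeight_degree_le : totalWeight (degree δ η) (coeff (degree δ η) (2 / 3 * δ))
    ≤ 5 * Real.log (degree δ η) := by
  have h := integral_abs_mollifier_le (d := degree δ η) (a := 2 / 3 * δ) (by linarith) (by linarith)
    (integral_bump_degree_pos h0 hδ hη hη1)
  have h2 := two_pi_div_integral_bump_le h0 hδ hη hη1
  have h3 := totalWeight_le (degree δ η) (2 / 3 * δ) (h.trans (by linarith))
  linarith [one_le_log_degree h0 hδ hη hη1]

theorem one_le_inv_sq_mul_log_sq : 1 ≤ η⁻¹ ^ 2 * Real.log (degree δ η) ^ 2 := by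
  have h1 : 1 ≤ η⁻¹ := (one_le_inv₀ hη).2 hη1.le
  exact one_le_mul_of_one_le_of_one_le (one_le_pow₀ h1)
    (one_le_pow₀ (one_le_log_degree h0 hδ hη hη1))

theorem batchSize_pos : 0 < batchSize δ η :=
  Nat.ceil_pos.2 (by linarith [one_le_inv_sq_mul_log_sq h0 hδ hη hη1])

theorem batchSize_le :
    (batchSize δ η : ℝ) ≤ 32401 * (η⁻¹ ^ 2 * Real.log (degree δ η) ^ 2) := by
  have h := one_le_inv_sq_mul_log_sq h0 hδ hη hη1
  refine (ceil_le_add_one_of_nonneg (by linarith)).trans ?_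
  linarith

/-- The constant in the batch size is `32400 = 16 · 5² · 9²`, from `𝓕 ≤ 5 log d` and the accuracy `η
/ 9`. -/
theorem totalWeight_sq_le_batchSize :
    16 * totalWeight (degree δ η) (coeff (degree δ η) (2 / 3 * δ)) ^ 2
      ≤ batchSize δ η * (η / 9) ^ 2 := by
  have h1 := totalWeight_degree_le h0 hδ hη hη1
  have h2 : 32400 * (η⁻¹ ^ 2 * Real.log (degree δ η) ^ 2) ≤ batchSize δ η := Nat.le_ceil _
  have h3 := totalWeight_nonneg (degree δ η) (coeff (degree δ η) (2 / 3 * δ))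
  calc 16 * totalWeight (degree δ η) (coeff (degree δ η) (2 / 3 * δ)) ^ 2
      ≤ 16 * (5 * Real.log (degree δ η)) ^ 2 := by gcongr
    _ = 32400 * (η⁻¹ ^ 2 * Real.log (degree δ η) ^ 2) * (η / 9) ^ 2 := by field_simp; ring
    _ ≤ _ := by gcongr

omit hη hη1

variable {ϑ : ℝ} (hϑ : 0 < ϑ) (hϑ1 : ϑ < 1)

include hϑ hϑ1

/-- `log log δ⁻¹` can be negative, but not below `-0.5`; the factor 2 in `log (2 ϑ⁻¹) ≥ 0.69`
compensates and keeps the sum positive. -/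
theorem log_log_add_ge : Real.log (2 * ϑ⁻¹) / 4 ≤ Real.log (Real.log δ⁻¹) + Real.log (2 * ϑ⁻¹) := by
  have h1 := log_log_ge (log_inv_ge h0 hδ)
  have h2 := log_two_mul_inv_ge hϑ hϑ1
  linarith

theorem batches_le :
    (batches δ ϑ : ℝ) ≤ 160 * (Real.log (Real.log δ⁻¹) + Real.log (2 * ϑ⁻¹)) := by
  have h1 := log_log_add_ge h0 hδ hϑ hϑ1
  have h2 := log_two_mul_inv_ge hϑ hϑ1
  refine (ceil_le_add_one_of_nonneg (by linarith)).trans ?_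
  linarith

theorem batches_pos : 0 < batches δ ϑ := by
  have h1 := log_log_add_ge h0 hδ hϑ hϑ1
  have h2 := log_two_mul_inv_ge hϑ hϑ1
  exact Nat.ceil_pos.2 (by linarith)

/-- The three summands in the number of batches give the factors `e⁻³ ≤ 1/20`, `1 / log δ⁻¹` and `ϑ
/ 2`; the first two cancel `2n ≤ 20 log δ⁻¹`. -/
theorem union_bound_le : 2 * iterations δ * Real.exp (-(batches δ ϑ / 8)) ≤ ϑ := by
  have hL := log_inv_ge h0 hδ
  have hn := iterations_le h0 hδ
  have hb : 8 * (3 + (Real.log (Real.log δ⁻¹) + Real.log (2 * ϑ⁻¹))) ≤ batches δ ϑ := Nat.le_ceil _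
  have he : Real.exp (-(batches δ ϑ / 8))
      ≤ Real.exp (-(3 + (Real.log (Real.log δ⁻¹) + Real.log (2 * ϑ⁻¹)))) :=
    Real.exp_le_exp.2 (by linarith)
  have he2 : Real.exp (-(3 + (Real.log (Real.log δ⁻¹) + Real.log (2 * ϑ⁻¹))))
      = (Real.exp 3)⁻¹ * ((Real.log δ⁻¹)⁻¹ * (2 * ϑ⁻¹)⁻¹) := by
    rw [Real.exp_neg, Real.exp_add, Real.exp_add, Real.exp_log (by linarith),
      Real.exp_log (by positivity), mul_inv, mul_inv]
  have hL0 : 0 < Real.log δ⁻¹ := by linarith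
  have h20 : (Real.exp 3)⁻¹ ≤ 20⁻¹ := by
    have := exp_three_ge
    gcongr
  have hcancel : ∀ L : ℝ, 0 < L → 2 * (10 * L) * (20⁻¹ * (L⁻¹ * (2 * ϑ⁻¹)⁻¹)) = ϑ / 2 := by
    intro L hL
    field_simp
    norm_num
  calc 2 * iterations δ * Real.exp (-(batches δ ϑ / 8))
      ≤ 2 * (10 * Real.log δ⁻¹) * (20⁻¹ * ((Real.log δ⁻¹)⁻¹ * (2 * ϑ⁻¹)⁻¹)) := by
        rw [he2] at he
        gcongr
        exact he.trans (by gcongr)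
    _ = ϑ / 2 := hcancel _ hL0
    _ ≤ ϑ := by linarith

include hη hη1

theorem batches_mul_batchSize_le : ((batches δ ϑ * batchSize δ η : ℕ) : ℝ) ≤
    5184160 * (η⁻¹ ^ 2 * Real.log (degree δ η) ^ 2
      * (Real.log (Real.log δ⁻¹) + Real.log (2 * ϑ⁻¹))) := by
  have h1 := batches_le h0 hδ hϑ hϑ1
  have h2 := batchSize_le h0 hδ hη hη1
  push_cast
  have h3 := one_le_inv_sq_mul_log_sq h0 hδ hη hη1
  have h4 := log_log_add_ge h0 hδ hϑ hϑ1
  have h5 := log_two_mul_inv_ge hϑ hϑ1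
  calc (batches δ ϑ : ℝ) * batchSize δ η
      ≤ 160 * (Real.log (Real.log δ⁻¹) + Real.log (2 * ϑ⁻¹))
        * (32401 * (η⁻¹ ^ 2 * Real.log (degree δ η) ^ 2)) := by
        refine mul_le_mul h1 h2 (by positivity) (by linarith)
    _ = _ := by ring

theorem steps_le : ((iterations δ + 1) * (batches δ ϑ * (batchSize δ η * 12 + 4) + 11) : ℝ)
    ≤ 324 * 5184160 * (Real.log δ⁻¹ * (η⁻¹ ^ 2 * Real.log (degree δ η) ^ 2
      * (Real.log (Real.log δ⁻¹) + Real.log (2 * ϑ⁻¹)))) := by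
  have hL := log_inv_ge h0 hδ
  have hM := batches_mul_batchSize_le h0 hδ hη hη1 hϑ hϑ1
  push_cast at hM
  have hb : (1 : ℝ) ≤ batches δ ϑ := by exact_mod_cast batches_pos h0 hδ hϑ hϑ1
  have hs : (1 : ℝ) ≤ batchSize δ η := by exact_mod_cast batchSize_pos h0 hδ hη hη1
  have h1 : (iterations δ + 1 : ℝ) ≤ 12 * Real.log δ⁻¹ := by
    linarith [iterations_le h0 hδ]
  -- `27 = 12 + 4 + 11`, since both counts are at least 1.
  have h2 : (batches δ ϑ * (batchSize δ η * 12 + 4) + 11 : ℝ)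
      ≤ 27 * (batches δ ϑ * batchSize δ η) := by nlinarith
  calc _ ≤ 12 * Real.log δ⁻¹ * (27 * (batches δ ϑ * batchSize δ η)) := by
        refine mul_le_mul h1 h2 (by positivity) (by positivity)
    _ = 324 * Real.log δ⁻¹ * (batches δ ϑ * batchSize δ η) := by ring
    _ ≤ 324 * Real.log δ⁻¹ * (5184160 * (η⁻¹ ^ 2 * Real.log (degree δ η) ^ 2
          * (Real.log (Real.log δ⁻¹) + Real.log (2 * ϑ⁻¹)))) := by gcongr
    _ = _ := by ring

/-- The logarithmic factors in the number of steps are absorbed by a power of the logarithm. -/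
theorem steps_polylog_le : Real.log δ⁻¹ * (η⁻¹ ^ 2 * Real.log (degree δ η) ^ 2
      * (Real.log (Real.log δ⁻¹) + Real.log (2 * ϑ⁻¹)))
    ≤ 10000 * polylogBound 4 (η⁻¹ ^ 2 * Real.log δ⁻¹ ^ 3 * Real.log (2 * ϑ⁻¹)) := by
  have hL := log_inv_ge h0 hδ
  have hT := log_two_mul_inv_ge hϑ hϑ1
  have hQ := log_log_add_ge h0 hδ hϑ hϑ1
  have hE := log_inv_nonneg hη hη1
  have hd1 := one_le_log_degree h0 hδ hη hη1
  have hd2 := log_degree_le h0 hδ hη hη1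
  rw [log_inv_mul_inv h0 hη] at hd2
  have hη' : 1 ≤ η⁻¹ := (one_le_inv₀ hη).2 hη1.le
  set L := Real.log δ⁻¹
  set T := Real.log (2 * ϑ⁻¹)
  set E := Real.log η⁻¹ with hEdef
  set f := η⁻¹ ^ 2 * L ^ 3 * T with hf
  have hL3 : (0.64 : ℝ) ^ 3 ≤ L ^ 3 := by gcongr
  have hLpos : 0 < L := by linarith
  have hf0 : 0 < f := by positivity
  have hlam : 0.69 ≤ Real.log (2 + f) := by
    have : Real.log 2 ≤ Real.log (2 + f) := Real.log_le_log (by norm_num) (by linarith)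
    linarith [Real.log_two_gt_d9]
  have h18 : -2 ≤ Real.log (1 / 6 : ℝ) := by
    rw [Real.le_log_iff_exp_le (by norm_num), Real.exp_neg, one_div]
    have h2 : Real.exp 2 = Real.exp 1 * Real.exp 1 := by rw [← Real.exp_add]; norm_num
    have h3 := Real.exp_one_gt_d9
    gcongr
    rw [h2]; nlinarith
  -- `L ^ 3 * T ≥ 1 / 6`, so `f` dominates `η⁻²` up to a constant and `log η⁻¹` is absorbed by `log
  -- (2 + f)`.
  have hEle : E ≤ 2 * Real.log (2 + f) := by
    have h1 : η⁻¹ ^ 2 * (1 / 6) ≤ 2 + f := by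
      have : η⁻¹ ^ 2 * (1 / 6) ≤ η⁻¹ ^ 2 * (L ^ 3 * T) := by
        gcongr
        nlinarith
      rw [hf, mul_assoc]; linarith
    have h2 := Real.log_le_log (by positivity) h1
    rw [Real.log_mul (by positivity) (by norm_num), Real.log_pow, ← hEdef] at h2
    push_cast at h2
    linarith
  have hLle : Real.log L ≤ Real.log (2 + f) := by
    have h1 : L ^ 3 * (1 / 2) ≤ 2 + f := by
      have : L ^ 3 * (1 / 2) ≤ η⁻¹ ^ 2 * (L ^ 3 * T) := by
        have h3 : L ^ 3 * (1 / 2) ≤ L ^ 3 * T := by gcongr; linarith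
        have h4 : 1 ≤ η⁻¹ ^ 2 := one_le_pow₀ hη'
        have h5 : 0 ≤ L ^ 3 * T := by positivity
        nlinarith
      rw [hf, mul_assoc]; linarith
    have h2 := Real.log_le_log (by positivity) h1
    rw [Real.log_mul (by positivity) (by norm_num), Real.log_pow, one_div, Real.log_inv] at h2
    push_cast at h2
    linarith [Real.log_two_lt_d9]
  unfold polylogBound
  set Λ := Real.log (2 + f)
  -- The sum of `L` and `Λ` is replaced by their product, as both are bounded below. Squared and
  -- multiplied by the iteration factor `L`, it produces exactly the `L ^ 3` in `f`.
  have hlogd : Real.log (degree δ η) ≤ 45 * (L * Λ) := by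
    nlinarith [mul_le_mul hL hlam (by norm_num) hLpos.le]
  have hQ0 : 0 ≤ Real.log L + T := by linarith
  have hQle : Real.log L + T ≤ 3 * (Λ * T) := by nlinarith
  calc L * (η⁻¹ ^ 2 * Real.log (degree δ η) ^ 2 * (Real.log L + T))
      ≤ L * (η⁻¹ ^ 2 * (45 * (L * Λ)) ^ 2 * (3 * (Λ * T))) := by gcongr
    _ = 6075 * (f * Λ ^ 3) := by rw [hf]; ring
    _ ≤ 10000 * (f * Λ ^ 4) := by
      have h1 : 0 ≤ f * Λ ^ 3 := by positivity
      have h2 : f * Λ ^ 4 = f * Λ ^ 3 * Λ := by ring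
      rw [h2]
      nlinarith

/-- The logarithmic factors in the evolution time are absorbed by a power of the logarithm. -/
theorem evolution_polylog_le : δ⁻¹ * Real.log (δ⁻¹ * η⁻¹) *
      (η⁻¹ ^ 2 * Real.log (degree δ η) ^ 2 * (Real.log (Real.log δ⁻¹) + Real.log (2 * ϑ⁻¹)))
    ≤ 4000 * polylogBound 4 (δ⁻¹ * η⁻¹ ^ 2 * Real.log (2 * ϑ⁻¹)) := by
  have hL := log_inv_ge h0 hδ
  have hT := log_two_mul_inv_ge hϑ hϑ1
  have hQ := log_log_add_ge h0 hδ hϑ hϑ1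
  have hE := log_inv_nonneg hη hη1
  have hX := log_inv_mul_inv_ge h0 hδ hη hη1
  have hd1 := one_le_log_degree h0 hδ hη hη1
  have hd2 := log_degree_le h0 hδ hη hη1
  have hsum := log_inv_mul_inv h0 hη
  have hη' : 1 ≤ η⁻¹ := (one_le_inv₀ hη).2 hη1.le
  have hLL := Real.log_le_sub_one_of_pos (x := Real.log δ⁻¹) (by linarith)
  set L := Real.log δ⁻¹
  set T := Real.log (2 * ϑ⁻¹)
  set X := Real.log (δ⁻¹ * η⁻¹) with hXdef
  set g := δ⁻¹ * η⁻¹ ^ 2 * T with hg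
  have hg0 : 0 < g := by positivity
  have hlam2 : Real.log 2 ≤ Real.log (2 + g) := Real.log_le_log (by norm_num) (by linarith)
  have hlam : 0.69 ≤ Real.log (2 + g) := by linarith [Real.log_two_gt_d9]
  have hXle : X ≤ 2 * Real.log (2 + g) := by
    -- Here `δ⁻¹` itself, not only its logarithm, is a factor of `g`, so the whole logarithm `X` is
    -- absorbed by `log (2 + g)`.
    have h1 : δ⁻¹ * η⁻¹ * (1 / 2) ≤ 2 + g := by
      have h3 : δ⁻¹ * η⁻¹ * (1 / 2) ≤ δ⁻¹ * η⁻¹ * (η⁻¹ * T) := by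
        gcongr
        nlinarith
      have h4 : δ⁻¹ * η⁻¹ * (η⁻¹ * T) = g := by rw [hg]; ring
      linarith
    have h2 := Real.log_le_log (by positivity) h1
    rw [Real.log_mul (by positivity) (by norm_num), one_div, Real.log_inv, ← hXdef] at h2
    linarith
  unfold polylogBound
  set Λ := Real.log (2 + g)
  have hlogd : Real.log (degree δ η) ≤ 18 * Λ := by linarith
  have hQ0 : 0 ≤ Real.log L + T := by linarith
  have hQle : Real.log L + T ≤ 5 * (Λ * T) := by nlinarith
  calc δ⁻¹ * X * (η⁻¹ ^ 2 * Real.log (degree δ η) ^ 2 * (Real.log L + T))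
      ≤ δ⁻¹ * (2 * Λ) * (η⁻¹ ^ 2 * (18 * Λ) ^ 2 * (5 * (Λ * T))) := by gcongr
    _ = 3240 * (g * Λ ^ 4) := by rw [hg]; ring
    _ ≤ 4000 * (g * Λ ^ 4) := by
      have h1 : 0 ≤ g * Λ ^ 4 := by positivity
      linarith

theorem samples_mul_degree_le :
    ((batches δ ϑ * batchSize δ η : ℕ) : ℝ) * degree δ η
      ≤ 10 ^ 13 * polylogBound 4 (δ⁻¹ * η⁻¹ ^ 2 * Real.log (2 * ϑ⁻¹)) := by
  have h1 := batches_mul_batchSize_le h0 hδ hη hη1 hϑ hϑ1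
  have h2 := degree_le h0 hδ hη hη1
  have h3 := evolution_polylog_le h0 hδ hη hη1 hϑ hϑ1
  have h5 : 0 ≤ polylogBound 4 (δ⁻¹ * η⁻¹ ^ 2 * Real.log (2 * ϑ⁻¹)) := by
    have hT := log_two_mul_inv_ge hϑ hϑ1
    unfold polylogBound
    have : 0 ≤ δ⁻¹ * η⁻¹ ^ 2 * Real.log (2 * ϑ⁻¹) := by positivity
    exact mul_nonneg this (pow_nonneg (Real.log_nonneg (by linarith)) _)
  have h4 := mul_le_mul h1 h2 (Nat.cast_nonneg _) (le_trans (Nat.cast_nonneg _) h1)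
  linarith

end Parameters

end InvertCDF

theorem mainTheorem2 :
    ∃ C : ℝ, 0 < C ∧ ∃ κ : ℕ, ∀ δ η : ℝ, 0 < δ → δ < Real.pi / 6 → 0 < η → η < 1 →
      ∃ d : ℕ,
        (d : ℝ) ≤ C * (δ⁻¹ * Real.log (δ⁻¹ * η⁻¹)) ∧
        ∀ ϑ : ℝ, 0 < ϑ → ϑ < 1 → ∃ Nb Ns : ℕ,
          ((Nb * Ns : ℕ) : ℝ) ≤
            C * (η⁻¹ ^ 2 * Real.log d ^ 2 * (Real.log (Real.log δ⁻¹) + Real.log (2 * ϑ⁻¹))) ∧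
          (∀ s : Fin (Nb * Ns) → Sample, ∃ (x : ℝ) (t : ℕ),
            Outputs (tableOf d (coeff d (2 / 3 * δ))) δ η s x t ∧
            (t : ℝ) ≤
              C * polylogBound κ (η⁻¹ ^ 2 * Real.log δ⁻¹ ^ 3 * Real.log (2 * ϑ⁻¹))) ∧
          ∀ (D : ℕ) (H ρ : Matrix (Fin D) (Fin D) ℂ) (hH : H.IsHermitian) (τ : ℝ),
            IsDensityMatrix ρ → 0 < τ →
            τ * ‖Matrix.toEuclideanCLM (n := Fin D) (𝕜 := ℂ) H‖ < Real.pi / 3 →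
            ∀ (Ω : Type*) [MeasurableSpace Ω] (P : MeasureTheory.Measure Ω)
              [MeasureTheory.IsProbabilityMeasure P] (S : Fin (Nb * Ns) → Ω → Sample),
              IsSampleFamily d (coeff d (2 / 3 * δ)) H ρ τ P S →
              P.real {ω | ∃ (x : ℝ) (t : ℕ),
                  Outputs (tableOf d (coeff d (2 / 3 * δ))) δ η (fun k => S k ω) x t ∧
                  Solves δ η (cdf hH ρ τ) x} ≥ 1 - ϑ ∧
              MeasureTheory.Integrable (fun ω => ∑ k, τ * |((S k ω).1 : ℝ)|) P ∧
              ∫ ω, ∑ k, τ * |((S k ω).1 : ℝ)| ∂P =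
                τ * (Nb * Ns : ℕ) * meanAbsJ d (coeff d (2 / 3 * δ)) ∧
              τ * (Nb * Ns : ℕ) * meanAbsJ d (coeff d (2 / 3 * δ)) ≤
                C * (τ * polylogBound κ (δ⁻¹ * η⁻¹ ^ 2 * Real.log (2 * ϑ⁻¹))) ∧
              (∀ᵐ ω ∂P, ∀ k, |(S k ω).1| ≤ d ∧ τ * |((S k ω).1 : ℝ)| ≤ τ * d) ∧
              τ * d ≤ C * (τ * δ⁻¹ * Real.log (δ⁻¹ * η⁻¹)) := by
  -- The largest constant needed is `324 * 5184160 * 10000`, about `1.7 * 10 ^ 13`, from the number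
  -- of steps. The exponent 4 is the one in both polylogarithmic bounds.
  refine ⟨10 ^ 14, by norm_num, 4, fun δ η h0 hδ hη hη1 => ⟨degree δ η, ?_, ?_⟩⟩
  · have h1 := degree_le h0 hδ hη hη1
    linarith [(Nat.cast_nonneg (degree δ η) : (0 : ℝ) ≤ degree δ η)]
  intro ϑ hϑ hϑ1
  refine ⟨batches δ ϑ, batchSize δ η, ?_, fun s => ?_, ?_⟩
  · have h1 := batches_mul_batchSize_le h0 hδ hη hη1 hϑ hϑ1
    linarith [(Nat.cast_nonneg (batches δ ϑ * batchSize δ η) :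
      (0 : ℝ) ≤ ((batches δ ϑ * batchSize δ η : ℕ) : ℝ))]
  · obtain ⟨x, t, hx, ht⟩ := exists_outputs (tableOf (degree δ η) (coeff (degree δ η) (2 / 3 * δ)))
      η s (gap_iterations_le h0 hδ)
    refine ⟨x, t, hx, ?_⟩
    have h1 : (t : ℝ) ≤ (iterations δ + 1) * (batches δ ϑ * (batchSize δ η * 12 + 4) + 11) := by
      exact_mod_cast ht
    have h2 := steps_le h0 hδ hη hη1 hϑ hϑ1
    have h3 := steps_polylog_le h0 hδ hη hη1 hϑ hϑ1
    linarith [(Nat.cast_nonneg t : (0 : ℝ) ≤ t)]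
  intro D H ρ hH τ hρ hτ hτH Ω _ P _ S hS
  have hτi := abs_mul_eigenvalues_lt hH hτ hτH
  refine ⟨?_, ?_, ?_, ?_, ?_, ?_⟩
  · exact hS.le_measureReal_solves hH hρ hτi h0 hδ hη hη1 (integral_bump_degree_pos h0 hδ hη hη1)
      (two_pi_div_integral_bump_le h0 hδ hη hη1) (gap_iterations_le h0 hδ)
      (batchSize_pos h0 hδ hη hη1) (totalWeight_sq_le_batchSize h0 hδ hη hη1)
      (union_bound_le h0 hδ hϑ hϑ1)
  · exact MeasureTheory.integrable_finsetSum _ fun k _ => (hS.integral_abs hH hρ k).1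
  · rw [MeasureTheory.integral_finsetSum _ fun k _ => (hS.integral_abs hH hρ k).1]
    simp_rw [fun k => (hS.integral_abs hH hρ k).2]
    rw [Finset.sum_const, Finset.card_univ, Fintype.card_fin, nsmul_eq_mul]
    ring
  · have h1 := meanAbsJ_le (degree δ η) (coeff (degree δ η) (2 / 3 * δ))
    have h2 := samples_mul_degree_le h0 hδ hη hη1 hϑ hϑ1
    have h3 : (0 : ℝ) ≤ ((batches δ ϑ * batchSize δ η : ℕ) : ℝ) := Nat.cast_nonneg _
    have h4 : ((batches δ ϑ * batchSize δ η : ℕ) : ℝ)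
        * meanAbsJ (degree δ η) (coeff (degree δ η) (2 / 3 * δ))
        ≤ 10 ^ 14 * polylogBound 4 (δ⁻¹ * η⁻¹ ^ 2 * Real.log (2 * ϑ⁻¹)) := by
      have h5 := mul_le_mul_of_nonneg_left h1 h3
      have h6 : 0 ≤ ((batches δ ϑ * batchSize δ η : ℕ) : ℝ) * (degree δ η : ℝ) := by positivity
      linarith
    have h7 := mul_le_mul_of_nonneg_left h4 hτ.le
    linarith
  · refine MeasureTheory.ae_all_iff.2 fun k => ?_
    filter_upwards [hS.ae_mem hH hρ k] with ω hω
    have hJ : |(S k ω).1| ≤ (degree δ η : ℤ) := abs_le.2 (Finset.mem_Icc.1 hω)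
    refine ⟨hJ, mul_le_mul_of_nonneg_left ?_ hτ.le⟩
    exact_mod_cast hJ
  · have h1 := degree_le h0 hδ hη hη1
    have h2 : (degree δ η : ℝ) ≤ 10 ^ 14 * (δ⁻¹ * Real.log (δ⁻¹ * η⁻¹)) := by
      linarith [(Nat.cast_nonneg (degree δ η) : (0 : ℝ) ≤ degree δ η)]
    have h3 := mul_le_mul_of_nonneg_left h2 hτ.le
    linarith
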